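/- Fix $n\ge 0$ and let $\mathbf{Man}$ be the category of smooth $n$-dimensional manifolds (Hausdorff, second countable, without boundary) and open embeddings (diffeomorphisms onto open subsets), with the Grothendieck topology of open covers and with the weak (compact-open) $C^\infty$ topology on the sets $\mathrm{Emb}(M,N)$ of open embeddings. A *topological sheaf* is a contravariant functor $\Phi$ from $\mathbf{Man}$ to topological spaces which is a sheaf of topological spaces and which is continuous, i.e. the maps $\mathrm{Emb}(M,N)\times\Phi(N)\to\Phi(M)$, $(f,x)\mapsto\Phi(f)(x)$, are continuous. For $M\in\mathbf{Man}$ let $\Phi^{\mathrm{fib}}(TM)\to M$ be the bundle with fibre $\Phi(T_pM)$ over $p$, obtained by applying $\Phi$ fibrewise to $TM$ (the bundle associated to the frame bundle of $M$ and the action of $\mathrm{GL}_n(\mathbb{R})$ on $\Phi(\mathbb{R}^n)$), and let $\Gamma(\Phi^{\mathrm{fib}}(TM))$ be its space of continuous sections with the compact-open topology. Let $M\in\mathbf{Man}$ carry a smooth Riemannian metric, and let $g\colon M\to(0,\infty)$ be a continuous injectivity radius: for every $p\in M$ the exponential map $\exp_p$ is defined on the open ball $B_{g(p)}(T_pM)$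 of radius $g(p)$ and is a diffeomorphism from it onto an open subset of $M$. Let $\theta_t$, $t>0$, be $\mathrm{O}(n)$-equivariant diffeomorphisms from $\mathbb{R}^n$ onto the open ball of radius $t$ in $\mathbb{R}^n$, depending continuously on $t$ in the $C^\infty$ topology; write $\theta_t\colon T_pM\to B_t(T_pM)$ also for the diffeomorphism obtained by conjugating $\theta_t$ with any linear isometry $\mathbb{R}^n\cong T_pM$. The *scanning map* sends $x\in\Phi(M)$ to $$\mathfrak{s}(x)\colon p\longmapsto \Phi\bigl(\exp_p\circ\,\theta_{g(p)}\bigr)(x)\in\Phi(T_pM).$$ If $\Phi$ is a topological sheaf, then, for all such $M$, Riemannian metrics, $g$ and $\theta$, the section $\mathfrak{s}(x)$ is continuous for every $x\in\Phi(M)$, and the scanning map $\mathfrak{s}\colon\Phi(M)\to\Gamma(\Phi^{\mathrm{fib}}(TM))$ is a topological embedding (a homeomorphism onto its image). -/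

import Mathlib

open CategoryTheory Opposite Set Topology
open scoped Manifold ContDiff InnerProductSpace

universe v

noncomputable section

namespace Scanning

/-- The Euclidean space `ℝⁿ`. -/
abbrev Eucl (n : ℕ) : Type := EuclideanSpace ℝ (Fin n)

/-! ### The category of manifolds and open embeddings -/

/-- Smooth `n`-dimensional manifolds: Hausdorff, second countable, without boundary. -/
structure Man (n : ℕ) : Type 1 where
  carrier : Type
  [topologicalSpace : TopologicalSpace carrier]
  [chartedSpace : ChartedSpace (Eucl n) carrier]
  [isManifold : IsManifold 𝓘(ℝ, Eucl n) ∞ carrier]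
  [t2Space : T2Space carrier]
  [secondCountable : SecondCountableTopology carrier]

instance (n : ℕ) : CoeSort (Man n) Type := ⟨Man.carrier⟩

attribute [instance] Man.topologicalSpace Man.chartedSpace Man.isManifold Man.t2Space
  Man.secondCountable

variable {n : ℕ}

/-- Open embeddings of smooth manifolds, that is, diffeomorphisms onto an open subset:
injective local diffeomorphisms. -/
@[ext]
structure OpenEmb (M N : Man n) : Type where
  toFun : M → N
  injective : Function.Injective toFun
  isLocalDiffeomorph : IsLocalDiffeomorph 𝓘(ℝ, Eucl n) 𝓘(ℝ, Eucl n) ∞ toFun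

theorem isLocalDiffeomorph_id (M : Man n) :
    IsLocalDiffeomorph 𝓘(ℝ, Eucl n) 𝓘(ℝ, Eucl n) ∞ (id : M → M) :=
  (Diffeomorph.refl 𝓘(ℝ, Eucl n) M ∞).isLocalDiffeomorph

instance : Category (Man n) where
  Hom M N := OpenEmb M N
  id M := ⟨id, Function.injective_id, isLocalDiffeomorph_id M⟩
  comp f g := ⟨g.toFun ∘ f.toFun, g.injective.comp f.injective,
    fun x => (f.isLocalDiffeomorph x).comp 𝓘(ℝ, Eucl n) _ (g.isLocalDiffeomorph (f.toFun x))⟩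

/-- The underlying function of an open embedding. -/
def fn {M N : Man n} (f : M ⟶ N) : M → N := OpenEmb.toFun f

theorem fn_injective {M N : Man n} (f : M ⟶ N) : Function.Injective (fn f) :=
  OpenEmb.injective f

theorem fn_isLocalDiffeomorph {M N : Man n} (f : M ⟶ N) :
    IsLocalDiffeomorph 𝓘(ℝ, Eucl n) 𝓘(ℝ, Eucl n) ∞ (fn f) :=
  OpenEmb.isLocalDiffeomorph f

theorem hom_ext {M N : Man n} {f g : M ⟶ N} (h : ∀ x, fn f x = fn g x) : f = g :=
  OpenEmb.ext (funext h)

theorem fn_comp {M N P : Man n} (f : M ⟶ N) (g : N ⟶ P) (x : M) :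
    fn (f ≫ g) x = fn g (fn f x) := rfl

/-! ### The site -/

/-- An open subset of a manifold, as a manifold. -/
def openSub (M : Man n) (U : TopologicalSpace.Opens M) : Man n := ⟨U⟩

/-- A function between manifolds is a local diffeomorphism as soon as its composition with
an injective local diffeomorphism is one. -/
theorem isLocalDiffeomorph_of_comp {M N P : Man n} {k : M → N} (h : N ⟶ P)
    (hk : IsLocalDiffeomorph 𝓘(ℝ, Eucl n) 𝓘(ℝ, Eucl n) ∞ (fn h ∘ k)) :
    IsLocalDiffeomorph 𝓘(ℝ, Eucl n) 𝓘(ℝ, Eucl n) ∞ k := by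
  intro x
  obtain ⟨F, hx, hF⟩ := hk x
  obtain ⟨G, hy, hG⟩ := fn_isLocalDiffeomorph h (k x)
  have key : ∀ y ∈ F.source, F.toPartialEquiv y ∈ G.target →
      k y = G.toPartialEquiv.symm (F.toPartialEquiv y) := by
    intro y hyF hyG
    apply fn_injective h
    rw [hG (G.toPartialEquiv.map_target hyG)]
    exact (hF hyF).trans (G.toPartialEquiv.right_inv hyG).symm
  refine ⟨F.trans G.symm, ⟨hx, ?_⟩, fun y hy => key y hy.1 hy.2⟩
  change F.toPartialEquiv x ∈ G.target
  have h1 : fn h (k x) = F.toPartialEquiv x := hF hx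
  rw [← h1, hG hy]
  exact G.toPartialEquiv.map_source hy

theorem isLocalDiffeomorph_subtypeVal (M : Man n) (U : TopologicalSpace.Opens M) :
    IsLocalDiffeomorph 𝓘(ℝ, Eucl n) 𝓘(ℝ, Eucl n) ∞ (Subtype.val : openSub M U → M) := by
  classical
  intro x
  refine ⟨{ toFun := Subtype.val
            invFun := fun y => if h : y ∈ U then ⟨y, h⟩ else x
            source := univ
            target := U
            map_source' := fun y _ => y.2
            map_target' := fun _ _ => mem_univ _
            left_inv' := fun y _ => dif_pos y.2
            right_inv' := fun y hy => by
              have hy' : y ∈ U := hy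
              simp [hy']
            open_source := isOpen_univ
            open_target := U.2
            contMDiffOn_toFun := (contMDiff_subtype_val (U := U)).contMDiffOn
            contMDiffOn_invFun := ?_ }, mem_univ _, fun _ _ => rfl⟩
  intro y hy
  refine (ContMDiffWithinAt.subtypeVal_comp_iff U _ _ _).1 ?_
  refine contMDiffWithinAt_id.congr (fun z hz => ?_) ?_
  · have hz' : z ∈ U := hz
    simp [hz']
  · have hy' : y ∈ U := hy
    simp [hy']

/-- The inclusion of an open subset. -/
def incl (M : Man n) (U : TopologicalSpace.Opens M) : openSub M U ⟶ M :=
  OpenEmb.mk Subtype.val Subtype.val_injective (isLocalDiffeomorph_subtypeVal M U)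

/-- The Grothendieck topology of open covers on `Man n`: a sieve on `M` is covering if the images
of its members cover `M`. -/
def openCoverTopology (n : ℕ) : GrothendieckTopology (Man n) where
  sieves M := {S | ∀ p : M, ∃ (N : Man n) (f : N ⟶ M), S f ∧ p ∈ range (fn f)}
  top_mem' M p := ⟨M, 𝟙 M, trivial, p, rfl⟩
  pullback_stable' := by
    intro X Y S f hS p
    obtain ⟨Z, h, hh, z, hz⟩ := hS (fn f p)
    let U : TopologicalSpace.Opens Y :=
      ⟨fn f ⁻¹' range (fn h), (fn_isLocalDiffeomorph h).isOpen_range.preimage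
        (fn_isLocalDiffeomorph f).contMDiff.continuous⟩
    let k : openSub Y U → Z := fun y => y.2.choose
    have hk : ∀ y, fn h (k y) = fn f y.1 := fun y => y.2.choose_spec
    have hcomp : fn h ∘ k = fn (incl Y U ≫ f) := funext hk
    let K : openSub Y U ⟶ Z := OpenEmb.mk k
      (fun a b hab => by
        have : fn (incl Y U ≫ f) a = fn (incl Y U ≫ f) b := by
          rw [← hcomp]; simp [hab]
        exact fn_injective _ this)
      (isLocalDiffeomorph_of_comp h (by rw [hcomp]; exact fn_isLocalDiffeomorph _))
    refine ⟨openSub Y U, incl Y U, ?_, ⟨p, ⟨z, hz⟩⟩, rfl⟩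
    have hKf : incl Y U ≫ f = K ≫ h := hom_ext fun y => (hk y).symm
    change S (incl Y U ≫ f)
    rw [hKf]
    exact S.downward_closed hh K
  transitive' := by
    intro X S hS R hR p
    obtain ⟨N, f, hf, q, rfl⟩ := hS p
    obtain ⟨N', f', hf', q', rfl⟩ := hR hf q
    exact ⟨N', f' ≫ f, hf', q', rfl⟩

/-! ### Continuous functors -/

/-- A subbasic open set of the smooth compact-open topology: the open embeddings `f` that map the
compact set `K`, contained in the domain of the chart `c`, into the domain of the chart `c'`, and
whose `k`-th derivative in these charts maps `K` to the open set `O`. -/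
def subbasicSet (M N : Man n) (c : OpenPartialHomeomorph M (Eucl n))
    (c' : OpenPartialHomeomorph N (Eucl n)) (K : Set M) (k : ℕ)
    (O : Set (ContinuousMultilinearMap ℝ (fun _ : Fin k => Eucl n) (Eucl n))) : Set (M ⟶ N) :=
  {f | MapsTo (fn f) K c'.source ∧
    ∀ x ∈ K, iteratedFDeriv ℝ k (c' ∘ fn f ∘ c.symm) (c x) ∈ O}

/-- The (weak, or compact-open) `C^∞` topology on the set of open embeddings `M → N`: uniform
convergence on compact sets of all derivatives in charts. -/
instance (M N : Man n) : TopologicalSpace (M ⟶ N) :=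
  TopologicalSpace.generateFrom
    {W | ∃ c ∈ atlas (Eucl n) M, ∃ c' ∈ atlas (Eucl n) N, ∃ K : Set M, IsCompact K ∧ K ⊆ c.source ∧
      ∃ (k : ℕ) (O : Set (ContinuousMultilinearMap ℝ (fun _ : Fin k => Eucl n) (Eucl n))),
        IsOpen O ∧ W = subbasicSet M N c c' K k O}

/-- A functor `Φ` from manifolds and open embeddings to topological spaces (contravariant, as
sheaves are) is continuous if `(f, x) ↦ Φ(f)(x)` is jointly continuous for all `M`, `N`. -/
def IsContinuousFunctor (Φ : (Man n)ᵒᵖ ⥤ TopCat.{v}) : Prop :=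
  ∀ M N : Man n, Continuous fun q : (M ⟶ N) × Φ.obj (op N) => Φ.map q.1.op q.2

/-- A topological sheaf on `Man n`: a continuous functor to topological spaces which is a sheaf
of topological spaces for open covers. -/
structure IsTopologicalSheaf (Φ : (Man n)ᵒᵖ ⥤ TopCat.{v}) : Prop where
  continuous : IsContinuousFunctor Φ
  isSheaf : Presheaf.IsSheaf (openCoverTopology n) Φ

/-! ### The bundle `Φ^fib(TM)` -/

/-- `ℝⁿ` as an object of `Man n`. -/
abbrev Rn (n : ℕ) : Man n := ⟨Eucl n⟩

/-- A linear isomorphism of `ℝⁿ` as an open embedding. -/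
def linEmb (A : Eucl n ≃L[ℝ] Eucl n) : Rn n ⟶ Rn n :=
  OpenEmb.mk A A.injective A.toDiffeomorph.isLocalDiffeomorph

/-- The (right) action of the linear isomorphisms of `ℝⁿ` on `Φ(ℝⁿ)`; noninvertible maps are set to
act as the identity. -/
def linAct (Φ : (Man n)ᵒᵖ ⥤ TopCat.{v}) (A : Eucl n →L[ℝ] Eucl n) (x : Φ.obj (op (Rn n))) :
    Φ.obj (op (Rn n)) :=
  open Classical in
  if h : ∃ e : Eucl n ≃L[ℝ] Eucl n, (e : Eucl n →L[ℝ] Eucl n) = A then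
    Φ.map (linEmb h.choose).op x else x

theorem linAct_coe (Φ : (Man n)ᵒᵖ ⥤ TopCat.{v}) (e : Eucl n ≃L[ℝ] Eucl n)
    (x : Φ.obj (op (Rn n))) : linAct Φ (e : Eucl n →L[ℝ] Eucl n) x = Φ.map (linEmb e).op x := by
  have h : ∃ e' : Eucl n ≃L[ℝ] Eucl n, (e' : Eucl n →L[ℝ] Eucl n) = e := ⟨e, rfl⟩
  rw [linAct, dif_pos h]
  rw [ContinuousLinearEquiv.coe_injective h.choose_spec]

theorem continuous_linEmb {X : Type*} [TopologicalSpace X] (A : X → (Eucl n ≃L[ℝ] Eucl n))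
    (hA : Continuous fun x => (A x : Eucl n →L[ℝ] Eucl n)) :
    Continuous fun x => linEmb (A x) := by
  refine continuous_generateFrom_iff.2 ?_
  rintro W ⟨c, hc, c', hc', K, hK, -, k, O, hO, rfl⟩
  have h1 : c = OpenPartialHomeomorph.refl (Eucl n) := hc
  have h2 : c' = OpenPartialHomeomorph.refl (Eucl n) := hc'
  subst h1 h2
  have hcont : Continuous fun q : X × Eucl n => iteratedFDeriv ℝ k (A q.1) q.2 := by
    have hA1 : Continuous fun q : X × Eucl n => (A q.1 : Eucl n →L[ℝ] Eucl n) :=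
      hA.comp continuous_fst
    cases k with
    | zero =>
      exact (continuousMultilinearCurryFin0 ℝ (Eucl n) (Eucl n)).symm.continuous.comp
        (hA1.clm_apply continuous_snd)
    | succ k =>
      have hd : ∀ x, fderiv ℝ (A x) = fun _ => (A x : Eucl n →L[ℝ] Eucl n) :=
        fun x => funext fun y => (A x).fderiv
      simp only [iteratedFDeriv_succ_eq_comp_right, hd, Function.comp_apply]
      refine (LinearIsometryEquiv.continuous _).comp ?_
      cases k with
      | zero =>
        exact (continuousMultilinearCurryFin0 ℝ (Eucl n)
          (Eucl n →L[ℝ] Eucl n)).symm.continuous.comp hA1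
      | succ k =>
        simp only [iteratedFDeriv_succ_const]
        exact continuous_const
  have hset : (fun x => linEmb (A x)) ⁻¹' subbasicSet (Rn n) (Rn n)
      (OpenPartialHomeomorph.refl (Eucl n)) (OpenPartialHomeomorph.refl (Eucl n)) K k O =
      {x | ∀ y ∈ K, iteratedFDeriv ℝ k (A x) y ∈ O} := by
    ext x
    constructor
    · exact fun h y hy => h.2 y hy
    · exact fun h => ⟨fun _ _ => mem_univ _, fun y hy => h y hy⟩
  rw [hset]
  refine isOpen_iff_mem_nhds.2 fun x hx => ?_
  obtain ⟨U, V, hU, hV, hxU, hKV, hUV⟩ := generalized_tube_lemma (isCompact_singleton (x := x)) hK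
    (hO.preimage hcont) (by rintro ⟨a, b⟩ ⟨rfl, hb⟩; exact hx b hb)
  filter_upwards [hU.mem_nhds (hxU rfl)] with a ha y hy
  exact hUV (show (a, y) ∈ U ×ˢ V from ⟨ha, hKV hy⟩)

/-- The change of trivialization of the tangent bundle from the chart `i` to the chart `j`. -/
abbrev tangentChange (M : Man n) (i j : atlas (Eucl n) M) (p : M) : Eucl n →L[ℝ] Eucl n :=
  (tangentBundleCore 𝓘(ℝ, Eucl n) M).coordChange i j p

/-- The changes of trivialization of the tangent bundle are invertible. -/
theorem exists_tangentChange (M : Man n) (i j : atlas (Eucl n) M) (p : M)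
    (hp : p ∈ i.1.source ∩ j.1.source) :
    ∃ e : Eucl n ≃L[ℝ] Eucl n, (e : Eucl n →L[ℝ] Eucl n) = tangentChange M i j p := by
  refine ⟨ContinuousLinearEquiv.equivOfInverse (tangentChange M i j p) (tangentChange M j i p)
    (fun v => ?_) (fun v => ?_), rfl⟩
  · rw [(tangentBundleCore 𝓘(ℝ, Eucl n) M).coordChange_comp i j i p ⟨hp, hp.1⟩,
      (tangentBundleCore 𝓘(ℝ, Eucl n) M).coordChange_self i p hp.1]
  · rw [(tangentBundleCore 𝓘(ℝ, Eucl n) M).coordChange_comp j i j p ⟨hp.symm, hp.2⟩,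
      (tangentBundleCore 𝓘(ℝ, Eucl n) M).coordChange_self j p hp.2]

/-- The bundle `Φ^fib(TM)` over `M`, obtained by applying `Φ` fibrewise to `TM`. Its fibre at `p` is
`Φ(T_pM)`, where `T_pM` is identified with `ℝⁿ` by the preferred chart at `p`, as in Mathlib's
definition of the tangent space. An element of `Φ(T_pM)` is represented in the trivialization of
`TM` at a chart `i` by its pullback along the inverse `ℝⁿ → T_pM` of the trivialization, so the
change from `i` to `j` is `Φ` of the linear change of trivialization of `TM` from `j` to `i`. This
is the bundle associated to the frame bundle of `M` and the action of `GL_n` on `Φ(ℝⁿ)`. -/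
def fibBundle (Φ : (Man n)ᵒᵖ ⥤ TopCat.{v}) (hΦ : IsContinuousFunctor Φ) (M : Man n) :
    FiberBundleCore (atlas (Eucl n) M) M (Φ.obj (op (Rn n))) where
  baseSet i := i.1.source
  isOpen_baseSet i := i.1.open_source
  indexAt := achart (Eucl n)
  mem_baseSet_at := mem_chart_source (Eucl n)
  coordChange i j p := linAct Φ (tangentChange M j i p)
  coordChange_self i p hp x := by
    have h : tangentChange M i i p = (ContinuousLinearEquiv.refl ℝ (Eucl n) : Eucl n →L[ℝ] Eucl n) :=
      ContinuousLinearMap.ext fun w =>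
        (tangentBundleCore 𝓘(ℝ, Eucl n) M).coordChange_self i p hp w
    rw [h, linAct_coe, show linEmb (ContinuousLinearEquiv.refl ℝ (Eucl n)) = 𝟙 (Rn n) from rfl]
    simp
  continuousOn_coordChange i j := by
    choose! A hA using exists_tangentChange M j i
    have hc := ((tangentBundleCore 𝓘(ℝ, Eucl n) M).continuousOn_coordChange j i).domRestrict
    have hAc : Continuous fun p : ↥(j.1.source ∩ i.1.source) =>
        ((A p : Eucl n ≃L[ℝ] Eucl n) : Eucl n →L[ℝ] Eucl n) := by
      rw [show (fun p : ↥(j.1.source ∩ i.1.source) => ((A p : Eucl n ≃L[ℝ] Eucl n) :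
        Eucl n →L[ℝ] Eucl n)) = fun p : ↥(j.1.source ∩ i.1.source) => tangentChange M j i p.1 from
          funext fun p => hA p p.2]
      exact hc
    have hE := continuous_linEmb _ hAc
    rw [continuousOn_iff_continuous_domRestrict]
    have hlift : Continuous fun q : ↥((i.1.source ∩ j.1.source) ×ˢ
        (univ : Set (Φ.obj (op (Rn n))))) =>
        ((⟨q.1.1, q.2.1.symm⟩ : ↥(j.1.source ∩ i.1.source)), q.1.2) := by fun_prop
    have hcomp := (hΦ (Rn n) (Rn n)).comp ((hE.prodMap continuous_id).comp hlift)
    convert hcomp using 1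
    funext q
    change linAct Φ (tangentChange M j i q.1.1) q.1.2 = _
    rw [← hA q.1.1 q.2.1.symm, linAct_coe]
    rfl
  coordChange_comp i j k p hp x := by
    obtain ⟨⟨hi, hj⟩, hk⟩ := hp
    obtain ⟨e, he⟩ := exists_tangentChange M j i p ⟨hj, hi⟩
    obtain ⟨e', he'⟩ := exists_tangentChange M k j p ⟨hk, hj⟩
    have h : tangentChange M k i p = ((e'.trans e : Eucl n ≃L[ℝ] Eucl n) :
        Eucl n →L[ℝ] Eucl n) := by
      ext1 w
      rw [← (tangentBundleCore 𝓘(ℝ, Eucl n) M).coordChange_comp k j i p ⟨⟨hk, hj⟩, hi⟩ w]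
      change (tangentChange M j i p) (tangentChange M k j p w) = _
      rw [← he, ← he']
      rfl
    rw [h, ← he, ← he', linAct_coe, linAct_coe, linAct_coe,
      show linEmb (e'.trans e) = linEmb e' ≫ linEmb e from rfl]
    simp

/-- The space `Γ(Φ^fib(TM))` of continuous sections, with the compact-open topology. -/
abbrev Sections (Φ : (Man n)ᵒᵖ ⥤ TopCat.{v}) (hΦ : IsContinuousFunctor Φ) (M : Man n) :=
  {s : C(M, (fibBundle Φ hΦ M).TotalSpace) // ∀ p, (s p).proj = p}

/-! ### The exponential map of a Riemannian metric -/

/-- Smooth Riemannian metrics on `M`. -/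
abbrev RiemMetric (M : Man n) :=
  Bundle.ContMDiffRiemannianMetric 𝓘(ℝ, Eucl n) ∞ (Eucl n)
    (fun p : M => TangentSpace 𝓘(ℝ, Eucl n) p)

variable {M : Man n}

/-- The inner product of `T_pM`. -/
def innerAt (g : RiemMetric M) (p : M) (u w : TangentSpace 𝓘(ℝ, Eucl n) p) : ℝ := g.inner p u w

/-- The coefficients of the metric in a chart `c`: the pullback of the metric along `c⁻¹`, evaluated
at the point `y` and the vectors `u`, `w`. -/
def coeff (g : RiemMetric M) (c : OpenPartialHomeomorph M (Eucl n)) (y u w : Eucl n) : ℝ :=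
  innerAt g (c.symm y) (mfderiv 𝓘(ℝ, Eucl n) 𝓘(ℝ, Eucl n) c.symm y u)
    (mfderiv 𝓘(ℝ, Eucl n) 𝓘(ℝ, Eucl n) c.symm y w)

/-- `γ` is a geodesic on the open interval `(a, b)`: it is smooth and in every chart the local
expression `x` of `γ` satisfies the geodesic equation, written as the Euler-Lagrange equation
`d/dt g_x(x', w) = ½ (∂_w g)_x(x', x')` for all constant `w`. -/
def IsGeodesicOn (g : RiemMetric M) (γ : ℝ → M) (a b : ℝ) : Prop :=
  ContMDiffOn 𝓘(ℝ, ℝ) 𝓘(ℝ, Eucl n) ∞ γ (Ioo a b) ∧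
  ∀ t ∈ Ioo a b, ∀ c ∈ atlas (Eucl n) M, γ t ∈ c.source → ∀ w : Eucl n,
    deriv (fun τ => coeff g c (c (γ τ)) (deriv (fun σ => c (γ σ)) τ) w) t =
      (1 / 2) * fderiv ℝ (fun y => coeff g c y (deriv (fun σ => c (γ σ)) t)
        (deriv (fun σ => c (γ σ)) t)) (c (γ t)) w

/-- `exp_p(v)` is defined and equal to `q`: there is a geodesic `γ`, defined on a neighbourhood of
`[0, 1]`, with `γ(0) = p`, `γ'(0) = v` and `γ(1) = q`. -/
def IsExp (g : RiemMetric M) (p : M) (v : TangentSpace 𝓘(ℝ, Eucl n) p) (q : M) : Prop :=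
  ∃ a < (0 : ℝ), ∃ b > (1 : ℝ), ∃ γ : ℝ → M, IsGeodesicOn g γ a b ∧
    (⟨γ 0, mfderiv 𝓘(ℝ, ℝ) 𝓘(ℝ, Eucl n) γ 0 (1 : ℝ)⟩ : TangentBundle 𝓘(ℝ, Eucl n) M) = ⟨p, v⟩ ∧
    γ 1 = q

/-- The exponential map `exp_p`, on `T_pM = ℝⁿ` (with value `p` where it is not defined). -/
def expMap (g : RiemMetric M) (p : M) (v : Rn n) : M :=
  open Classical in if h : ∃ q, IsExp g p v q then h.choose else p

/-- The open ball of radius `r` in `T_pM`. -/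
def tangentBall (g : RiemMetric M) (p : M) (r : ℝ) : Set (Rn n) := {v | innerAt g p v v < r ^ 2}

/-- `r : M → (0, ∞)` is an injectivity radius: for every `p`, the exponential map `exp_p` is
defined on the open ball of radius `r(p)` in `T_pM`, and it is a diffeomorphism from it onto an
open subset of `M`. -/
structure IsInjectivityRadius (g : RiemMetric M) (r : C(M, Ioi (0 : ℝ))) : Prop where
  exists_exp : ∀ p, ∀ v ∈ tangentBall g p (r p), ∃ q, IsExp g p v q
  injOn : ∀ p, InjOn (expMap g p) (tangentBall g p (r p))
  isLocalDiffeomorphOn : ∀ p, IsLocalDiffeomorphOn 𝓘(ℝ, Eucl n) 𝓘(ℝ, Eucl n) ∞ (expMap g p)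
    (tangentBall g p (r p))

/-! ### The scanning map -/

/-- A family `θ_t`, `t > 0`, of `O(n)`-equivariant diffeomorphisms from `ℝⁿ` to the open ball of
radius `t` in `ℝⁿ`, depending continuously on `t`. -/
structure BallFamily (n : ℕ) where
  theta : Ioi (0 : ℝ) → (Rn n ⟶ Rn n)
  continuous : Continuous theta
  range_eq : ∀ t, range (fn (theta t)) = Metric.ball (0 : Eucl n) t
  equivariant : ∀ t (A : Eucl n ≃ₗᵢ[ℝ] Eucl n) (v : Eucl n), fn (theta t) (A v) = A (fn (theta t) v)

theorem exists_linearEquiv_core {V : Type*} [AddCommGroup V] [Module ℝ V]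
    [FiniteDimensional ℝ V]   (c : InnerProductSpace.Core ℝ V) (hV : Module.finrank ℝ V = n) :
    ∃ L : Eucl n ≃ₗ[ℝ] V, ∀ v w : Eucl n, c.inner (L v) (L w) = ⟪v, w⟫_ℝ := by
  let : NormedAddCommGroup V := c.toNormedAddCommGroup
  let : InnerProductSpace ℝ V := InnerProductSpace.ofCore c.toCore
  let b := (stdOrthonormalBasis ℝ V).reindex (finCongr hV)
  exact ⟨b.repr.symm.toLinearEquiv, fun v w => b.repr.symm.inner_map_map v w⟩

theorem exists_orthonormalFrame (g : RiemMetric M) (p : M) :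
    ∃ L : Eucl n ≃L[ℝ] Eucl n, ∀ v w : Eucl n, innerAt g p (L v) (L w) = ⟪v, w⟫_ℝ := by
  have : FiniteDimensional ℝ (TangentSpace 𝓘(ℝ, Eucl n) p) :=
    inferInstanceAs (FiniteDimensional ℝ (Eucl n))
  obtain ⟨L, hL⟩ := exists_linearEquiv_core (n := n) (V := TangentSpace 𝓘(ℝ, Eucl n) p)
    (g.toRiemannianMetric.toCore p) (finrank_euclideanSpace_fin (𝕜 := ℝ) (n := n))
  let L' : Eucl n ≃ₗ[ℝ] Eucl n := L
  exact ⟨L'.toContinuousLinearEquiv, hL⟩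

/-- An orthonormal frame of `T_pM`, that is, a linear isometry `ℝⁿ → T_pM`. -/
def frame (g : RiemMetric M) (p : M) : Eucl n ≃L[ℝ] Eucl n := (exists_orthonormalFrame g p).choose

theorem innerAt_frame (g : RiemMetric M) (p : M) (v w : Eucl n) :
    innerAt g p (frame g p v) (frame g p w) = ⟪v, w⟫_ℝ := (exists_orthonormalFrame g p).choose_spec v w

/-- The diffeomorphism `θ_t : T_pM → B_t(T_pM)`, transported from `ℝⁿ` along a linear
isometry `ℝⁿ → T_pM`; by equivariance it does not depend on the isometry. -/
def thetaAt (θ : BallFamily n) (g : RiemMetric M) (p : M) (t : Ioi (0 : ℝ)) : Rn n ⟶ Rn n :=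
  linEmb (frame g p).symm ≫ θ.theta t ≫ linEmb (frame g p)

theorem thetaAt_mem (θ : BallFamily n) (g : RiemMetric M) (p : M) (t : Ioi (0 : ℝ)) (v : Rn n) :
    fn (thetaAt θ g p t) v ∈ tangentBall g p t := by
  have h : fn (θ.theta t) ((frame g p).symm v) ∈ Metric.ball (0 : Eucl n) t := by
    rw [← θ.range_eq t]; exact mem_range_self _
  have ht : (0 : ℝ) < t := t.2
  change innerAt g p (frame g p (fn (θ.theta t) ((frame g p).symm v)))
    (frame g p (fn (θ.theta t) ((frame g p).symm v))) < (t : ℝ) ^ 2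
  rw [innerAt_frame, real_inner_self_eq_norm_sq]
  rw [mem_ball_zero_iff] at h
  gcongr

/-- The open embedding `exp_p ∘ θ_{r(p)} : T_pM → M`. -/
def expTheta (θ : BallFamily n) (g : RiemMetric M) (r : C(M, Ioi (0 : ℝ)))
    (hr : IsInjectivityRadius g r) (p : M) : Rn n ⟶ M :=
  OpenEmb.mk (fun v => expMap g p (fn (thetaAt θ g p (r p)) v))
    (fun _ _ h => fn_injective _
      (hr.injOn p (thetaAt_mem θ g p (r p) _) (thetaAt_mem θ g p (r p) _) h))
    (fun v => (fn_isLocalDiffeomorph (thetaAt θ g p (r p)) v).comp 𝓘(ℝ, Eucl n) _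
      (hr.isLocalDiffeomorphOn p ⟨_, thetaAt_mem θ g p (r p) v⟩))

/-- The scanning map on points: `x ∈ Φ(M)` and `p ∈ M` are sent to the element
`Φ(exp_p ∘ θ_{r(p)})(x)` of `Φ(T_pM)`. -/
def scan (Φ : (Man n)ᵒᵖ ⥤ TopCat.{v}) (hΦ : IsContinuousFunctor Φ) (θ : BallFamily n)
    (g : RiemMetric M) (r : C(M, Ioi (0 : ℝ))) (hr : IsInjectivityRadius g r)
    (x : Φ.obj (op M)) (p : M) : (fibBundle Φ hΦ M).TotalSpace :=
  ⟨p, Φ.map (expTheta θ g r hr p).op x⟩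

end Scanning

end

open CategoryTheory Opposite Scanning Topology

/-! The scanning map is controlled by the embeddings `expTheta θ g r hr p`, that is, `exp_p ∘
θ_{r(p)}`. If they depend continuously on `p` once the tangent spaces are trivialized over a chart
(`continuousAt_expTheta`), then joint continuity of `(f, x) ↦ Φ(f)(x)` makes `(x, p) ↦ 𝔰(x)(p)`
continuous (`continuous_scan`). Fixing `x` gives continuous sections, and currying gives continuity
of `𝔰` for the compact-open topology.

The converse is the sheaf property. The image of `exp_p ∘ θ_{r(p)}` contains `p = exp_p(0)`, so
these images form an open cover of `M`. Hence an element of `Φ(M)` is determined by its restrictions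
along them (`eq_of_map_eq`), and a map into `Φ(M)` is continuous as soon as all these restrictions
are (`continuous_of_cover`). The restrictions are the values of the section at the points `p`, and
evaluation at a point is continuous on sections; so `𝔰` is injective and the topology of `Φ(M)` is
induced.

The analytic work is the continuity in `p`, with all derivatives in `v`. It has two sources.

Geodesics depend smoothly on initial data. In a chart the Legendre transformation turns the
Euler-Lagrange equation into a first-order system. Its short time flow is smooth because the
integral equation is solved by inverting a smooth perturbation of the identity on `C([0,1], E)`
(`exists_contDiff_flow`), and connectedness of `[0,1]` propagates this along a whole geodesic
(`smoothDependence_geodesic`). No geodesic is constructed: the injectivity radius supplies them, and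
it is enough that all existing ones follow one smooth function of the initial state.

The orthonormal frames that define `θ` on `T_pM` are arbitrary choices, not continuous in `p`. They
are locally bounded, so along an ultrafilter they converge, to a limit that differs from the chosen
frame at the limit point by an orthogonal map (`exists_tendsto_frames`). Equivariance of `θ` cancels
that map (`smoothTendsto_conj`). -/

noncomputable section

namespace Scanning

set_option maxSynthPendingDepth 3

/-! ### Superposition operators and flows of globally Lipschitz vector fields -/

section Superposition

universe u
variable {X : Type*} [TopologicalSpace X] [CompactSpace X]
variable {E F : Type u} [NormedAddCommGroup E] [NormedSpace ℝ E] [NormedAddCommGroup F]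
  [NormedSpace ℝ F]

/-- Pointwise evaluation of a continuous family of linear maps on a continuous family of vectors. -/
def pointwiseApply (X : Type*) [TopologicalSpace X] [CompactSpace X] (E F : Type u)
    [NormedAddCommGroup E] [NormedSpace ℝ E] [NormedAddCommGroup F] [NormedSpace ℝ F] :
    C(X, E →L[ℝ] F) →L[ℝ] C(X, E) →L[ℝ] C(X, F) :=
  LinearMap.mkContinuous₂
    (LinearMap.mk₂ ℝ (fun (A : C(X, E →L[ℝ] F)) (h : C(X, E)) => (⟨fun t => A t (h t), by fun_prop⟩ : C(X, F)))
      (fun _ _ _ => by ext; simp) (fun _ _ _ => by ext; simp)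
      (fun _ _ _ => by ext; simp) (fun _ _ _ => by ext; simp)) 1
    (fun A h => by
      refine (ContinuousMap.norm_le _ (by positivity)).2 fun t => ?_
      rw [one_mul]
      exact (A t).le_of_opNorm_le_of_le (A.norm_coe_le_norm t) (h.norm_coe_le_norm t))

/-- Postcomposition with `fderiv ℝ f` is continuous in the supremum norm, so the derivative of `f`
varies by at most `ε` along the segments from `α t` to `β t`, uniformly in `t`. The mean value
inequality then bounds the remainder. -/
theorem hasFDerivAt_superposition {f : E → F} (hf : ContDiff ℝ 1 f) (α : C(X, E)) :
    HasFDerivAt (fun β : C(X, E) => (⟨f, hf.continuous⟩ : C(E, F)).comp β)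
      (pointwiseApply X E F
        ((⟨fderiv ℝ f, hf.continuous_fderiv one_ne_zero⟩ : C(E, E →L[ℝ] F)).comp α)) α := by
  set D : C(E, E →L[ℝ] F) := ⟨fderiv ℝ f, hf.continuous_fderiv one_ne_zero⟩
  rw [hasFDerivAt_iff_isLittleO, Asymptotics.isLittleO_iff]
  intro ε hε
  have hD : Continuous fun β : C(X, E) => D.comp β := ContinuousMap.continuous_postcomp D
  obtain ⟨δ, hδ, hball⟩ := Metric.mem_nhds_iff.1
    (hD.continuousAt.preimage_mem_nhds (Metric.ball_mem_nhds (D.comp α) hε))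
  filter_upwards [Metric.ball_mem_nhds α hδ] with β hβ
  refine (ContinuousMap.norm_le _ (by positivity)).2 fun t => ?_
  have hseg : ∀ x ∈ segment ℝ (α t) (β t), ‖fderiv ℝ f x - fderiv ℝ f (α t)‖ ≤ ε := by
    intro x hx
    rw [segment_eq_image'] at hx
    obtain ⟨s, hs, rfl⟩ := hx
    have h1 : dist (α + s • (β - α)) α < δ := by
      rw [dist_eq_norm, add_sub_cancel_left, norm_smul, Real.norm_of_nonneg hs.1]
      calc s * ‖β - α‖ ≤ 1 * ‖β - α‖ := by gcongr; exact hs.2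
        _ < δ := by rw [one_mul, ← dist_eq_norm]; exact hβ
    have h2 := (ContinuousMap.dist_lt_iff hε).1 (Metric.mem_ball.1 (hball (Metric.mem_ball.2 h1))) t
    rw [dist_eq_norm] at h2
    exact h2.le
  have := (convex_segment (α t) (β t)).norm_image_sub_le_of_norm_fderiv_le' (𝕜 := ℝ)
    (f := f) (φ := fderiv ℝ f (α t)) (C := ε)
    (fun x _ => (hf.differentiable one_ne_zero) x) hseg (left_mem_segment ℝ _ _)
    (right_mem_segment ℝ _ _)
  refine this.trans ?_
  gcongr
  exact (β - α).norm_coe_le_norm t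

/-- The derivative is again a superposition operator, that of `fderiv ℝ f`, followed by a bounded
linear map. This gives an induction on the order, with varying target space. -/
theorem contDiff_superposition_nat (n : ℕ) {f : E → F} (hf : ContDiff ℝ n f) :
    ContDiff ℝ n (fun β : C(X, E) => (⟨f, hf.continuous⟩ : C(E, F)).comp β) := by
  induction n generalizing F with
  | zero =>
    exact contDiff_zero.2 (ContinuousMap.continuous_postcomp _)
  | succ n ih =>
    have h1 : ContDiff ℝ 1 f := hf.of_le (by exact_mod_cast Nat.le_add_left 1 n)
    have h2 : ContDiff ℝ n (fderiv ℝ f) := hf.fderiv_right (by norm_cast)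
    push_cast
    rw [contDiff_succ_iff_fderiv]
    refine ⟨fun α => (hasFDerivAt_superposition h1 α).differentiableAt, by simp, ?_⟩
    rw [show fderiv ℝ (fun β : C(X, E) => (⟨f, hf.continuous⟩ : C(E, F)).comp β) = fun α =>
      pointwiseApply X E F ((⟨fderiv ℝ f, h2.continuous⟩ : C(E, E →L[ℝ] F)).comp α) from
        funext fun α => (hasFDerivAt_superposition h1 α).fderiv]
    exact (pointwiseApply X E F).contDiff.comp (ih h2)

theorem contDiff_superposition {f : E → F} (hf : ContDiff ℝ ∞ f) :
    ContDiff ℝ ∞ (fun β : C(X, E) => (⟨f, hf.continuous⟩ : C(E, F)).comp β) :=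
  contDiff_infty.2 fun n => contDiff_superposition_nat n (contDiff_infty.1 hf n)

/-- The integration operator `α ↦ ∫₀ᵗ α` on continuous curves `[0, 1] → E`. -/
def integration (E : Type u) [NormedAddCommGroup E] [NormedSpace ℝ E] :
    C(Icc (0 : ℝ) 1, E) →L[ℝ] C(Icc (0 : ℝ) 1, E) :=
  LinearMap.mkContinuous
    { toFun := fun α => ⟨fun t => ∫ s in (0 : ℝ)..t, IccExtend zero_le_one α s,
        (intervalIntegral.continuous_primitive
          (fun a b => (α.continuous.Icc_extend' (h := zero_le_one)).intervalIntegrable a b) 0).comp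
            continuous_subtype_val⟩
      map_add' := fun α β => by
        ext t
        simp only [ContinuousMap.coe_mk, ContinuousMap.add_apply]
        rw [← intervalIntegral.integral_add
          ((α.continuous.Icc_extend' (h := zero_le_one)).intervalIntegrable _ _)
          ((β.continuous.Icc_extend' (h := zero_le_one)).intervalIntegrable _ _)]
        rfl
      map_smul' := fun c α => by
        ext t
        simp only [ContinuousMap.coe_mk, ContinuousMap.smul_apply, RingHom.id_apply]
        rw [← intervalIntegral.integral_smul]
        rfl } 1
    (fun α => by
      refine (ContinuousMap.norm_le _ (by positivity)).2 fun t => ?_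
      have := intervalIntegral.norm_integral_le_of_norm_le_const (a := (0 : ℝ)) (b := t)
        (f := IccExtend zero_le_one α) (C := ‖α‖) (fun s _ => α.norm_coe_le_norm _)
      refine this.trans ?_
      rw [sub_zero, abs_of_nonneg t.2.1, mul_comm]
      gcongr
      exact t.2.2)

theorem integration_apply (α : C(Icc (0 : ℝ) 1, E)) (t : Icc (0 : ℝ) 1) :
    integration E α t = ∫ s in (0 : ℝ)..t, IccExtend zero_le_one α s := rfl

theorem norm_integration_le : ‖integration E‖ ≤ 1 :=
  LinearMap.mkContinuous_norm_le _ zero_le_one _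

/-- The flow in time `τ` of a smooth vector field with Lipschitz constant `K`, `|τ| K < 1`: there is
a smooth map that sends the initial value of each integral curve to its value at time `τ`. -/
theorem exists_contDiff_flow [CompleteSpace E] {f : E → E} (hf : ContDiff ℝ ∞ f) {K : NNReal}
    (hK : LipschitzWith K f) {τ : ℝ} (hτ : |τ| * K < 1) :
    ∃ φ : E → E, ContDiff ℝ ∞ φ ∧ ∀ α : C(Icc (0 : ℝ) 1, E),
      (∀ t : Icc (0 : ℝ) 1, α t = α ⟨0, by simp⟩ +
        τ • ∫ s in (0 : ℝ)..t, IccExtend zero_le_one (f ∘ α) s) →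
      α ⟨1, by simp⟩ = φ (α ⟨0, by simp⟩) := by
  set I := Icc (0 : ℝ) 1
  let N : C(I, E) → C(I, E) := fun β => (⟨f, hf.continuous⟩ : C(E, E)).comp β
  let V := integration E
  have hN : ContDiff ℝ ∞ N := contDiff_superposition hf
  let G : C(I, E) → C(I, E) := fun α => α - τ • V (N α)
  have hG : ContDiff ℝ ∞ G := contDiff_id.sub ((V.contDiff.comp hN).const_smul τ)
  have hV : ∀ a, ‖V a‖ ≤ ‖a‖ := fun a => by
    simpa using V.le_of_opNorm_le norm_integration_le a
  let c : NNReal := Real.nnabs τ * K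
  have hc1 : c < 1 := by
    rw [← NNReal.coe_lt_coe]; simpa [c] using hτ
  have hNl : ∀ a b, ‖N a - N b‖ ≤ K * ‖a - b‖ := fun a b => by
    refine (ContinuousMap.norm_le _ (by positivity)).2 fun t => ?_
    have h1 : ‖f (a t) - f (b t)‖ ≤ K * ‖a t - b t‖ := by
      simpa [dist_eq_norm] using hK.dist_le_mul (a t) (b t)
    refine h1.trans ?_
    gcongr
    exact (a - b).norm_coe_le_norm t
  -- `G` differs from the identity by a map with Lipschitz constant `|τ| K < 1`, hence is a
  -- homeomorphism of the curve space.
  have happ : ApproximatesLinearOn G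
      ((ContinuousLinearEquiv.refl ℝ C(I, E) : C(I, E) ≃L[ℝ] C(I, E)) :
        C(I, E) →L[ℝ] C(I, E)) univ c := by
    intro a _ b _
    have : G a - G b - ((ContinuousLinearEquiv.refl ℝ C(I, E) : C(I, E) ≃L[ℝ] C(I, E)) :
        C(I, E) →L[ℝ] C(I, E)) (a - b) = -(τ • V (N a - N b)) := by
      simp only [G, map_sub, smul_sub, ContinuousLinearEquiv.coe_coe,
        ContinuousLinearEquiv.coe_refl', id]
      abel
    rw [this, norm_neg, norm_smul]
    calc ‖τ‖ * ‖V (N a - N b)‖ ≤ |τ| * (K * ‖a - b‖) := by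
          rw [Real.norm_eq_abs]
          gcongr
          exact (hV _).trans (hNl a b)
      _ = c * ‖a - b‖ := by simp [c, mul_assoc]
  have hcN : Subsingleton C(I, E) ∨ c <
      ‖((ContinuousLinearEquiv.refl ℝ C(I, E)).symm : C(I, E) →L[ℝ] C(I, E))‖₊⁻¹ := by
    rcases subsingleton_or_nontrivial C(I, E) with h | h
    · exact Or.inl h
    · refine Or.inr ?_
      have : ‖((ContinuousLinearEquiv.refl ℝ C(I, E)).symm : C(I, E) →L[ℝ] C(I, E))‖₊ = 1 :=
        NNReal.coe_injective ContinuousLinearMap.norm_id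
      rw [this, inv_one]
      exact hc1
  let H := happ.toHomeomorph G hcN
  have hHG : ∀ a, H a = G a := fun a => rfl
  have hder : ∀ a, ∃ e : C(I, E) ≃L[ℝ] C(I, E), HasFDerivAt H (e : C(I, E) →L[ℝ] C(I, E)) a := by
    intro a
    have hd : HasFDerivAt G (fderiv ℝ G a) a := (hG.differentiable (by simp) a).hasFDerivAt
    -- `T` is the derivative of the contraction `b ↦ b - G b`, so `‖T‖ < 1` and the Neumann series
    -- inverts `1 - T`, the derivative of `G`.
    let T : C(I, E) →L[ℝ] C(I, E) := 1 - fderiv ℝ G a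
    have hT : ‖T‖ < 1 := by
      have h1 : HasFDerivAt (fun b => b - G b) T a := (hasFDerivAt_id a).sub hd
      refine lt_of_le_of_lt ?_ hτ
      have h2 : LipschitzWith c (fun b => b - G b) := by
        refine LipschitzWith.of_dist_le_mul fun x y => ?_
        have := happ x (mem_univ x) y (mem_univ y)
        rw [dist_eq_norm, dist_eq_norm]
        refine le_trans (le_of_eq ?_) this
        rw [← norm_neg]
        congr 1
        simp only [ContinuousLinearEquiv.coe_coe,
          ContinuousLinearEquiv.coe_refl', id]
        abel
      have h3 := h1.le_of_lipschitz h2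
      simpa [c] using h3
    let e := ContinuousLinearEquiv.ofUnit (Units.oneSub T hT)
    refine ⟨e, ?_⟩
    have : (e : C(I, E) →L[ℝ] C(I, E)) = fderiv ℝ G a := by
      change (1 - T) = _
      simp [T]
    rw [this]
    exact hd
  choose H' hH' using hder
  have hinv : ContDiff ℝ ∞ H.symm := H.contDiff_symm hH' hG
  let ι : E →L[ℝ] C(I, E) := ContinuousLinearMap.const ℝ I
  let ev : C(I, E) →L[ℝ] E := ContinuousMap.evalCLM ℝ (⟨1, by simp [I]⟩ : I)
  -- The integral equation says that `G` maps the curve to the constant curve at its initial value.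
  -- Inverting `G` and evaluating at time `1` gives the flow.
  refine ⟨fun x => ev (H.symm (ι x)), ev.contDiff.comp (hinv.comp ι.contDiff), fun α hα => ?_⟩
  have h1 : H α = ι (α ⟨0, by simp⟩) := by
    rw [hHG]
    ext t
    change α t - τ • integration E (N α) t = α ⟨0, _⟩
    rw [sub_eq_iff_eq_add, integration_apply]
    exact hα t
  change _ = ev (H.symm (ι _))
  rw [← h1, H.symm_apply_apply]
  rfl

end Superposition

/-! ### Short time flows on open subsets -/

section LocalFlow

universe u
variable {E : Type u} [NormedAddCommGroup E] [NormedSpace ℝ E]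

/-- A smooth vector field on an open set agrees near each point with a smooth vector field of
compact support. -/
theorem exists_hasCompactSupport_eqOn [FiniteDimensional ℝ E] {f : E → E} {Ω : Set E}
    (hΩ : IsOpen Ω) (hf : ContDiffOn ℝ ∞ f Ω) {z₀ : E} (hz₀ : z₀ ∈ Ω) :
    ∃ ρ > 0, Metric.closedBall z₀ ρ ⊆ Ω ∧ ∃ f' : E → E, ContDiff ℝ ∞ f' ∧ HasCompactSupport f' ∧
      EqOn f' f (Metric.closedBall z₀ ρ) := by
  obtain ⟨δ, hδ, hδΩ⟩ := Metric.isOpen_iff.1 hΩ z₀ hz₀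
  let b : ContDiffBump z₀ := ⟨δ / 3, δ / 2, by positivity, by linarith⟩
  have hsub : Metric.closedBall z₀ (δ / 2) ⊆ Ω :=
    (Metric.closedBall_subset_ball (by linarith)).trans hδΩ
  refine ⟨δ / 3, by positivity, (Metric.closedBall_subset_closedBall (by linarith)).trans hsub,
    fun x => b x • f x, ?_, ?_, fun x hx => ?_⟩
  · refine contDiff_iff_contDiffAt.2 fun x => ?_
    by_cases hx : x ∈ Ω
    · exact b.contDiff.contDiffAt.smul (hf.contDiffAt (hΩ.mem_nhds hx))
    · have hx' : x ∈ (Metric.closedBall z₀ (δ / 2))ᶜ := fun h => hx (hsub h)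
      refine contDiffAt_const (c := (0 : E)) |>.congr_of_eventuallyEq ?_
      filter_upwards [Metric.isClosed_closedBall.isOpen_compl.mem_nhds hx'] with y hy
      have : b y = 0 := b.zero_of_le_dist (by
        rw [mem_compl_iff, Metric.mem_closedBall, not_le] at hy; exact hy.le)
      simp [this]
  · exact b.hasCompactSupport.smul_right
  · have : b x = 1 := b.one_of_mem_closedBall hx
    simp [this]

/-- Short time flows of a smooth vector field `f` on an open set `Ω`. The integral curves `z` in
time `τ` are given only on a set `D` of parameters in `[0, 1]`, in which they cannot leave a closed
ball; the conclusion is that `D` is everything and that `z 1` depends smoothly on `z 0`. -/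
theorem exists_local_flow [FiniteDimensional ℝ E] {f : E → E} {Ω : Set E}
    (hΩ : IsOpen Ω) (hf : ContDiffOn ℝ ∞ f Ω) {z₀ : E} (hz₀ : z₀ ∈ Ω) :
    ∃ ρ > 0, Metric.closedBall z₀ (2 * ρ) ⊆ Ω ∧ ∃ ε > 0, ∀ τ : ℝ, |τ| < ε →
      ∃ φ : E → E, ContDiff ℝ ∞ φ ∧ ∀ (z : ℝ → E) (D : Set ℝ),
        (∀ σ ∈ Icc (0 : ℝ) 1, σ ∈ D →
          D ∈ 𝓝 σ ∧ (z σ ∈ Ω → HasDerivAt z (τ • f (z σ)) σ)) →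
        IsClosed {σ | σ ∈ Icc (0 : ℝ) 1 ∧ σ ∈ D ∧ z σ ∈ Metric.closedBall z₀ (2 * ρ)} →
        0 ∈ D → z 0 ∈ Metric.ball z₀ ρ → 1 ∈ D ∧ z 1 = φ (z 0) := by
  obtain ⟨ρ', hρ', hρΩ, f', hf', hsupp, hff'⟩ := exists_hasCompactSupport_eqOn hΩ hf hz₀
  obtain ⟨ρ, rfl⟩ : ∃ ρ, 2 * ρ = ρ' := ⟨ρ' / 2, by ring⟩
  have hρ : 0 < ρ := by linarith
  obtain ⟨K, hK⟩ := hf'.lipschitzWith_of_hasCompactSupport hsupp (by simp)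
  obtain ⟨C, hC⟩ := hsupp.exists_bound_of_continuous hf'.continuous
  have hC0 : 0 ≤ C := (norm_nonneg _).trans (hC z₀)
  -- The first bound gives `|τ| K < 1` for the flow theorem. The second gives `|τ| C < ρ`, so a
  -- curve that starts in the ball of radius `ρ` stays in the ball of radius `2ρ`.
  refine ⟨ρ, hρ, hρΩ, min (1 / (K + 1)) (ρ / (C + 1)), by positivity, fun τ hτ => ?_⟩
  have hτK : |τ| * K < 1 := by
    have h := hτ.trans_le (min_le_left _ _)
    rw [lt_div_iff₀ (by positivity)] at h
    nlinarith [abs_nonneg τ]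
  have hτC : |τ| * C < ρ := by
    have h := hτ.trans_le (min_le_right _ _)
    rw [lt_div_iff₀ (by positivity)] at h
    nlinarith [abs_nonneg τ]
  obtain ⟨φ, hφ, hφz⟩ := exists_contDiff_flow hf' hK hτK
  refine ⟨φ, hφ, fun z D hD hcl h0 hz0 => ?_⟩
  have hder : ∀ σ ∈ Icc (0 : ℝ) 1, σ ∈ D → z σ ∈ Metric.closedBall z₀ (2 * ρ) →
      HasDerivAt z (τ • f' (z σ)) σ := fun σ hσ hσD hzσ => by
    rw [hff' hzσ]; exact (hD σ hσ hσD).2 (hρΩ hzσ)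
  have hball : Metric.ball z₀ ρ ⊆ Metric.closedBall z₀ (2 * ρ) :=
    Metric.ball_subset_closedBall.trans (Metric.closedBall_subset_closedBall (by linarith))
  -- Continuity argument: the bound on the displacement makes `s` closed, and keeps the curve
  -- strictly inside the larger ball, so that `s` can be extended to the right of each of its points
  -- below `1`.
  let s : Set ℝ := {σ | σ ∈ {σ | σ ∈ Icc (0 : ℝ) 1 ∧ σ ∈ D ∧ z σ ∈ Metric.closedBall z₀ (2 * ρ)} ∧
    ‖z σ - z 0‖ ≤ |τ| * C * σ}
  have hs : Icc (0 : ℝ) 1 ⊆ s := by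
    refine IsClosed.Icc_subset_of_forall_mem_nhdsWithin ?_ ?_ ?_
    · rw [inter_eq_left.2 (fun σ hσ => hσ.1.1)]
      refine hcl.isClosed_le ?_ (by fun_prop)
      intro σ hσ
      exact ((hder σ hσ.1 hσ.2.1 hσ.2.2).continuousAt.sub continuousAt_const).norm.continuousWithinAt
    · exact ⟨⟨⟨le_rfl, zero_le_one⟩, h0, hball hz0⟩, by simp⟩
    · rintro x ⟨⟨⟨hx, hxD, hxz⟩, hxn⟩, hx'⟩
      have hzx : z x ∈ Metric.ball z₀ (2 * ρ) := by
        rw [Metric.mem_ball] at hz0 ⊢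
        calc dist (z x) z₀ ≤ dist (z x) (z 0) + dist (z 0) z₀ := dist_triangle _ _ _
          _ < ρ + ρ := by
            rw [dist_eq_norm (z x)]
            refine add_lt_add (hxn.trans_lt (lt_of_le_of_lt ?_ hτC)) hz0
            exact mul_le_of_le_one_right (by positivity) hx.2
          _ = 2 * ρ := by ring
      have hev : ∀ᶠ y in 𝓝 x, y ∈ D ∧ z y ∈ Metric.ball z₀ (2 * ρ) :=
        Filter.Eventually.and (hD x hx hxD).1 ((hder x hx hxD hxz).continuousAt.eventually
          (Metric.isOpen_ball.mem_nhds hzx))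
      obtain ⟨δ, hδ, hball'⟩ := Metric.eventually_nhds_iff.1 hev
      filter_upwards [Ioo_mem_nhdsGT (lt_min hx'.2 (by linarith : x < x + δ))] with y hy
      have hy1 : y < 1 := hy.2.trans_le (min_le_left _ _)
      have hyδ : y < x + δ := hy.2.trans_le (min_le_right _ _)
      have hseg : ∀ w ∈ Icc x y, w ∈ Icc (0 : ℝ) 1 ∧ w ∈ D ∧ z w ∈ Metric.ball z₀ (2 * ρ) :=
        fun w hw => ⟨⟨hx.1.trans hw.1, hw.2.trans hy1.le⟩, hball' (by
          rw [Real.dist_eq, abs_of_nonneg (by linarith [hw.1])]; linarith [hw.2])⟩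
      have hyy := hseg y ⟨hy.1.le, le_rfl⟩
      refine ⟨⟨hyy.1, hyy.2.1, Metric.ball_subset_closedBall hyy.2.2⟩, ?_⟩
      have := norm_image_sub_le_of_norm_deriv_le_segment' (f := z) (a := x) (b := y)
        (f' := fun w => τ • f' (z w)) (C := |τ| * C)
        (fun w hw => (hder w (hseg w hw).1 (hseg w hw).2.1
          (Metric.ball_subset_closedBall (hseg w hw).2.2)).hasDerivWithinAt)
        (fun w _ => by rw [norm_smul, Real.norm_eq_abs]; gcongr; exact hC _) y ⟨hy.1.le, le_rfl⟩
      calc ‖z y - z 0‖ ≤ ‖z y - z x‖ + ‖z x - z 0‖ := norm_sub_le_norm_sub_add_norm_sub _ _ _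
        _ ≤ |τ| * C * (y - x) + |τ| * C * x := add_le_add this hxn
        _ = |τ| * C * y := by ring
  refine ⟨(hs ⟨zero_le_one, le_rfl⟩).1.2.1, ?_⟩
  have hd : ∀ σ ∈ Icc (0 : ℝ) 1, HasDerivAt z (τ • f' (z σ)) σ := fun σ hσ =>
    hder σ hσ (hs hσ).1.2.1 (hs hσ).1.2.2
  let α : C(Icc (0 : ℝ) 1, E) := ⟨fun σ => z σ, continuous_iff_continuousAt.2 fun σ =>
    (hd σ σ.2).continuousAt.comp continuous_subtype_val.continuousAt⟩
  refine hφz α fun t => ?_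
  have hsub : uIcc (0 : ℝ) t ⊆ Icc 0 1 := by
    rw [uIcc_of_le t.2.1]; exact Icc_subset_Icc_right t.2.2
  have hcont : ContinuousOn (fun s => τ • f' (z s)) (uIcc (0 : ℝ) t) := fun s hs' =>
    ((hf'.continuous.continuousAt.comp (hd s (hsub hs')).continuousAt).const_smul
      τ).continuousWithinAt
  have := intervalIntegral.integral_eq_sub_of_hasDerivAt (f := z) (fun s hs' => hd s (hsub hs'))
    hcont.intervalIntegrable
  have h2 : ∫ s in (0 : ℝ)..t, IccExtend zero_le_one (f' ∘ α) s = ∫ s in (0 : ℝ)..t, f' (z s) :=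
    intervalIntegral.integral_congr fun s hs' => by
      rw [IccExtend_of_mem _ _ (hsub hs')]; rfl
  rw [h2, ← intervalIntegral.integral_smul, this]
  simp [α]

end LocalFlow

/-! ### The metric in charts -/

section Metric

variable {n : ℕ} {M : Man n}

/-- The derivative of the inverse of a chart, as a map from `ℝⁿ` to the tangent space, which is `ℝⁿ`
by means of the preferred chart. -/
def symmDeriv (c : OpenPartialHomeomorph M (Eucl n)) (y : Eucl n) : Eucl n →L[ℝ] Eucl n :=
  mfderiv 𝓘(ℝ, Eucl n) 𝓘(ℝ, Eucl n) c.symm y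

/-- The metric in a chart, as a bilinear form. -/
def coeffForm (g : RiemMetric M) (c : OpenPartialHomeomorph M (Eucl n)) (y : Eucl n) :
    Eucl n →L[ℝ] Eucl n →L[ℝ] ℝ :=
  ContinuousLinearMap.bilinearComp (g.inner (c.symm y) : Eucl n →L[ℝ] Eucl n →L[ℝ] ℝ)
    (symmDeriv c y) (symmDeriv c y)

theorem coeffForm_apply (g : RiemMetric M) (c : OpenPartialHomeomorph M (Eucl n))
    (y u w : Eucl n) : coeffForm g c y u w = coeff g c y u w := rfl

theorem coeff_eq_innerAt (g : RiemMetric M) (c : OpenPartialHomeomorph M (Eucl n))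
    (y u w : Eucl n) : coeff g c y u w = innerAt g (c.symm y) (symmDeriv c y u) (symmDeriv c y w) :=
  rfl

theorem contMDiffOn_symm {c : OpenPartialHomeomorph M (Eucl n)} (hc : c ∈ atlas (Eucl n) M) :
    ContMDiffOn 𝓘(ℝ, Eucl n) 𝓘(ℝ, Eucl n) ∞ c.symm c.target :=
  contMDiffOn_symm_of_mem_maximalAtlas (IsManifold.subset_maximalAtlas hc)

theorem contMDiffOn_chart {c : OpenPartialHomeomorph M (Eucl n)} (hc : c ∈ atlas (Eucl n) M) :
    ContMDiffOn 𝓘(ℝ, Eucl n) 𝓘(ℝ, Eucl n) ∞ c c.source :=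
  contMDiffOn_of_mem_maximalAtlas (IsManifold.subset_maximalAtlas hc)

theorem contDiffOn_coordChange {c c' : OpenPartialHomeomorph M (Eucl n)}
    (hc : c ∈ atlas (Eucl n) M) (hc' : c' ∈ atlas (Eucl n) M) :
    ContDiffOn ℝ ∞ (c' ∘ c.symm) (c.target ∩ c.symm ⁻¹' c'.source) := by
  rw [← contMDiffOn_iff_contDiffOn]
  exact (contMDiffOn_chart hc').comp ((contMDiffOn_symm hc).mono inter_subset_left) inter_subset_right

theorem contDiffAt_coordChange {c c' : OpenPartialHomeomorph M (Eucl n)}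
    (hc : c ∈ atlas (Eucl n) M) (hc' : c' ∈ atlas (Eucl n) M) {y : Eucl n} (hy : y ∈ c.target)
    (hy' : c.symm y ∈ c'.source) : ContDiffAt ℝ ∞ (c' ∘ c.symm) y :=
  (contDiffOn_coordChange hc hc').contDiffAt
    ((c.symm.isOpen_inter_preimage c'.open_source).mem_nhds ⟨hy, hy'⟩)

/-- The section in question is the constant vector field `u` pushed forward by the tangent map of
`c.symm`. -/
theorem contMDiffAt_symmDeriv {c : OpenPartialHomeomorph M (Eucl n)} (hc : c ∈ atlas (Eucl n) M)
    (u : Eucl n) {y : Eucl n} (hy : y ∈ c.target) :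
    ContMDiffAt 𝓘(ℝ, Eucl n) (𝓘(ℝ, Eucl n).prod 𝓘(ℝ, Eucl n)) ∞
      (fun y => (⟨c.symm y, symmDeriv c y u⟩ : TangentBundle 𝓘(ℝ, Eucl n) M)) y := by
  have hsec : ContMDiffAt 𝓘(ℝ, Eucl n) (𝓘(ℝ, Eucl n).prod 𝓘(ℝ, Eucl n)) ∞
      (fun y => (⟨y, u⟩ : TangentBundle 𝓘(ℝ, Eucl n) (Eucl n))) y := by
    rw [← contMDiffWithinAt_univ]
    exact contMDiffWithinAt_vectorSpace_iff_contDiffWithinAt.2 contDiffWithinAt_const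
  have htan := (contMDiffOn_symm hc).contMDiffOn_tangentMapWithin (m := ∞) (by simp)
    c.open_target.uniqueMDiffOn
  have hopen : IsOpen (Bundle.TotalSpace.proj ⁻¹' c.target :
      Set (TangentBundle 𝓘(ℝ, Eucl n) (Eucl n))) :=
    c.open_target.preimage (FiberBundle.continuous_proj _ _)
  have h1 := (htan.contMDiffAt (x := (⟨y, u⟩ : TangentBundle 𝓘(ℝ, Eucl n) (Eucl n)))
    (hopen.mem_nhds hy)).comp y hsec
  refine h1.congr_of_eventuallyEq ?_
  filter_upwards [c.open_target.mem_nhds hy] with z hz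
  simp only [Function.comp_apply, tangentMapWithin]
  rw [mfderivWithin_of_isOpen c.open_target hz]
  rfl

theorem contDiffOn_coeffForm (g : RiemMetric M) {c : OpenPartialHomeomorph M (Eucl n)}
    (hc : c ∈ atlas (Eucl n) M) : ContDiffOn ℝ ∞ (coeffForm g c) c.target := by
  refine contDiffOn_clm_apply.2 fun u => contDiffOn_clm_apply.2 fun w => ?_
  intro y hy
  refine ContDiffAt.contDiffWithinAt ?_
  rw [← contMDiffAt_iff_contDiffAt]
  have h : ContMDiffAt 𝓘(ℝ, Eucl n) (𝓘(ℝ, Eucl n).prod 𝓘(ℝ, ℝ)) ∞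
      (fun y => Bundle.TotalSpace.mk' ℝ (E := Bundle.Trivial M ℝ) (c.symm y)
        (g.inner (c.symm y) (symmDeriv c y u) (symmDeriv c y w))) y := by
    apply ContMDiffAt.clm_bundle_apply₂ (F₁ := Eucl n) (F₂ := Eucl n)
      (E₁ := fun p : M => TangentSpace 𝓘(ℝ, Eucl n) p)
      (E₂ := fun p : M => TangentSpace 𝓘(ℝ, Eucl n) p)
    · exact g.contMDiff.contMDiffAt.comp y
        ((contMDiffOn_symm hc).contMDiffAt (c.open_target.mem_nhds hy))
    · exact contMDiffAt_symmDeriv hc u hy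
    · exact contMDiffAt_symmDeriv hc w hy
  rw [Bundle.contMDiffAt_totalSpace] at h
  exact h.2

/-- The derivative of the inverse of a chart in terms of the preferred chart. -/
theorem symmDeriv_eq_fderiv {c : OpenPartialHomeomorph M (Eucl n)} (hc : c ∈ atlas (Eucl n) M)
    {y : Eucl n} (hy : y ∈ c.target) :
    symmDeriv c y = fderiv ℝ (chartAt (Eucl n) (c.symm y) ∘ c.symm) y := by
  have h : MDifferentiableAt 𝓘(ℝ, Eucl n) 𝓘(ℝ, Eucl n) c.symm y :=
    ((contMDiffOn_symm hc).contMDiffAt (c.open_target.mem_nhds hy)).mdifferentiableAt (by simp)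
  refine h.mfderiv.trans ?_
  simp only [mfld_simps, fderivWithin_univ]
  rfl

/-- Links derivatives of charts to the cocycle of the tangent bundle, from which `fibBundle` is
built; invertibility is then inherited from the cocycle. -/
theorem symmDeriv_eq_tangentChange (c : atlas (Eucl n) M) {y : Eucl n} (hy : y ∈ c.1.target) :
    symmDeriv c.1 y = tangentChange M c (achart (Eucl n) (c.1.symm y)) (c.1.symm y) := by
  rw [symmDeriv_eq_fderiv c.2 hy]
  simp only [tangentChange, tangentBundleCore_coordChange, mfld_simps, fderivWithin_univ]
  rw [c.1.right_inv hy]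

theorem symmDeriv_chart (c : atlas (Eucl n) M) {p : M} (hp : p ∈ c.1.source) :
    symmDeriv c.1 (c.1 p) = tangentChange M c (achart (Eucl n) p) p := by
  rw [symmDeriv_eq_tangentChange c (c.1.map_source hp), c.1.left_inv hp]

theorem exists_symmDeriv {c : OpenPartialHomeomorph M (Eucl n)} (hc : c ∈ atlas (Eucl n) M)
    {y : Eucl n} (hy : y ∈ c.target) :
    ∃ e : Eucl n ≃L[ℝ] Eucl n, (e : Eucl n →L[ℝ] Eucl n) = symmDeriv c y := by
  rw [symmDeriv_eq_tangentChange ⟨c, hc⟩ hy]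
  exact exists_tangentChange M _ _ _ ⟨c.map_target hy, mem_chart_source _ _⟩

theorem innerAt_pos (g : RiemMetric M) (p : M) {u : Eucl n} (hu : u ≠ 0) : 0 < innerAt g p u u :=
  g.pos p u hu

theorem coeff_pos (g : RiemMetric M) {c : OpenPartialHomeomorph M (Eucl n)}
    (hc : c ∈ atlas (Eucl n) M) {y : Eucl n} (hy : y ∈ c.target) {u : Eucl n} (hu : u ≠ 0) :
    0 < coeff g c y u u := by
  obtain ⟨e, he⟩ := exists_symmDeriv hc hy
  rw [coeff_eq_innerAt, ← he]
  exact innerAt_pos g _ (e.map_ne_zero_iff.2 hu)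

theorem coeff_chart (g : RiemMetric M) (c : atlas (Eucl n) M) {p : M} (hp : p ∈ c.1.source)
    (u w : Eucl n) : coeff g c.1 (c.1 p) u w =
      innerAt g p (tangentChange M c (achart (Eucl n) p) p u)
        (tangentChange M c (achart (Eucl n) p) p w) := by
  rw [coeff_eq_innerAt, symmDeriv_chart c hp, c.1.left_inv hp]

/-- Positive definiteness gives injectivity, and the dimensions agree. -/
theorem exists_coeffForm_equiv (g : RiemMetric M) {c : OpenPartialHomeomorph M (Eucl n)}
    (hc : c ∈ atlas (Eucl n) M) {y : Eucl n} (hy : y ∈ c.target) :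
    ∃ e : Eucl n ≃L[ℝ] (Eucl n →L[ℝ] ℝ), (e : Eucl n →L[ℝ] Eucl n →L[ℝ] ℝ) = coeffForm g c y := by
  let L : Eucl n →ₗ[ℝ] (Eucl n →L[ℝ] ℝ) := (coeffForm g c y).toLinearMap
  have hinj : Function.Injective L := by
    refine (injective_iff_map_eq_zero L).2 fun u hu => ?_
    by_contra h
    have h1 := coeff_pos g hc hy h
    have h2 : coeffForm g c y u u = 0 := by
      change L u u = 0
      rw [hu]; rfl
    rw [coeffForm_apply] at h2
    exact h1.ne' h2
  have hdim : Module.finrank ℝ (Eucl n) = Module.finrank ℝ (Eucl n →L[ℝ] ℝ) :=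
    ((InnerProductSpace.toDual ℝ (Eucl n)).toLinearEquiv).finrank_eq
  exact ⟨(LinearEquiv.ofInjectiveOfFinrankEq L hinj hdim).toContinuousLinearEquiv,
    by ext; rfl⟩

end Metric

/-! ### Smooth dependence of geodesics on their initial values -/

section Geodesic

variable {n : ℕ} {M : Man n} {g : RiemMetric M}

/-- The Hamiltonian vector field of the geodesic flow in the chart `c`. -/
def hamiltonianField (g : RiemMetric M) (c : OpenPartialHomeomorph M (Eucl n))
    (z : Eucl n × (Eucl n →L[ℝ] ℝ)) : Eucl n × (Eucl n →L[ℝ] ℝ) :=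
  ((coeffForm g c z.1).inverse z.2,
    (1 / 2 : ℝ) • ((fderiv ℝ (coeffForm g c) z.1).flip ((coeffForm g c z.1).inverse z.2)).flip
      ((coeffForm g c z.1).inverse z.2))

/-- Position and velocity in the chart `c` of a curve. -/
def chartState (c : OpenPartialHomeomorph M (Eucl n)) (γ : ℝ → M) (t : ℝ) : Eucl n × Eucl n :=
  (c (γ t), deriv (fun σ => c (γ σ)) t)

/-- The Legendre transformation from velocities to momenta in the chart `c`. -/
def legendre (g : RiemMetric M) (c : OpenPartialHomeomorph M (Eucl n)) (s : Eucl n × Eucl n) :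
    Eucl n × (Eucl n →L[ℝ] ℝ) := (s.1, coeffForm g c s.1 s.2)

/-- The inverse of the Legendre transformation. -/
def legendreInv (g : RiemMetric M) (c : OpenPartialHomeomorph M (Eucl n))
    (z : Eucl n × (Eucl n →L[ℝ] ℝ)) : Eucl n × Eucl n := (z.1, (coeffForm g c z.1).inverse z.2)

variable {c : OpenPartialHomeomorph M (Eucl n)}

theorem inverse_coeffForm_apply (hc : c ∈ atlas (Eucl n) M) {y : Eucl n} (hy : y ∈ c.target)
    (u : Eucl n) : (coeffForm g c y).inverse (coeffForm g c y u) = u := by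
  obtain ⟨e, he⟩ := exists_coeffForm_equiv g hc hy
  rw [← he, ContinuousLinearMap.inverse_equiv]
  exact e.symm_apply_apply u

theorem legendreInv_legendre (hc : c ∈ atlas (Eucl n) M) {s : Eucl n × Eucl n}
    (hs : s.1 ∈ c.target) : legendreInv g c (legendre g c s) = s :=
  Prod.ext rfl (inverse_coeffForm_apply hc hs s.2)

theorem contDiffOn_legendre (hc : c ∈ atlas (Eucl n) M) :
    ContDiffOn ℝ ∞ (legendre g c) (c.target ×ˢ univ) :=
  contDiffOn_fst.prodMk (((contDiffOn_coeffForm g hc).comp contDiffOn_fst fun _ h => h.1).clm_apply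
    contDiffOn_snd)

theorem contDiffOn_inverse_coeffForm (hc : c ∈ atlas (Eucl n) M) :
    ContDiffOn ℝ ∞ (fun y => (coeffForm g c y).inverse) c.target := fun y hy => by
  obtain ⟨e, he⟩ := exists_coeffForm_equiv g hc hy
  have h : ContDiffAt ℝ ∞ ContinuousLinearMap.inverse (coeffForm g c y) := by
    rw [← he]
    exact contDiffAt_map_inverse e
  exact h.comp_contDiffWithinAt y (contDiffOn_coeffForm g hc y hy)

theorem contDiffOn_legendreInv (hc : c ∈ atlas (Eucl n) M) :
    ContDiffOn ℝ ∞ (legendreInv g c) (c.target ×ˢ univ) :=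
  contDiffOn_fst.prodMk (((contDiffOn_inverse_coeffForm hc).comp contDiffOn_fst
    fun _ h => h.1).clm_apply contDiffOn_snd)

theorem contDiffOn_hamiltonianField (hc : c ∈ atlas (Eucl n) M) :
    ContDiffOn ℝ ∞ (hamiltonianField g c) (c.target ×ˢ univ) := by
  have hinv : ContDiffOn ℝ ∞ (fun z : Eucl n × (Eucl n →L[ℝ] ℝ) =>
      (coeffForm g c z.1).inverse z.2) (c.target ×ˢ univ) :=
    contDiff_snd.comp_contDiffOn (contDiffOn_legendreInv hc)
  refine hinv.prodMk (ContDiffOn.const_smul _ (contDiffOn_clm_apply.2 fun w => ?_))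
  simp only [ContinuousLinearMap.flip_apply]
  have hD : ContDiffOn ℝ ∞ (fun z : Eucl n × (Eucl n →L[ℝ] ℝ) => fderiv ℝ (coeffForm g c) z.1)
      (c.target ×ˢ univ) :=
    ((contDiffOn_coeffForm g hc).fderiv_of_isOpen c.open_target (by simp)).comp contDiffOn_fst
      fun _ h => h.1
  exact ((hD.clm_apply contDiffOn_const).clm_apply hinv).clm_apply hinv

theorem IsGeodesicOn.contMDiffAt {γ : ℝ → M} {a b t : ℝ} (hγ : IsGeodesicOn g γ a b)
    (ht : t ∈ Ioo a b) : ContMDiffAt 𝓘(ℝ, ℝ) 𝓘(ℝ, Eucl n) ∞ γ t :=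
  hγ.1.contMDiffAt (isOpen_Ioo.mem_nhds ht)

theorem IsGeodesicOn.contDiffAt_chart {γ : ℝ → M} {a b t : ℝ} (hγ : IsGeodesicOn g γ a b)
    (ht : t ∈ Ioo a b) (hc : c ∈ atlas (Eucl n) M) (htc : γ t ∈ c.source) :
    ContDiffAt ℝ ∞ (fun σ => c (γ σ)) t := by
  rw [← contMDiffAt_iff_contDiffAt]
  exact ((contMDiffOn_chart hc).contMDiffAt (c.open_source.mem_nhds htc)).comp t
    (hγ.contMDiffAt ht)

/-- For the momentum `g_x(x', ·)` the geodesic equation is a first-order system. The position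
component says that inverting the metric recovers the velocity; the momentum component is the
Euler-Lagrange equation tested on each `w`. -/
theorem IsGeodesicOn.hasDerivAt {γ : ℝ → M} {a b t : ℝ} (hγ : IsGeodesicOn g γ a b)
    (ht : t ∈ Ioo a b) (hc : c ∈ atlas (Eucl n) M) (htc : γ t ∈ c.source) :
    HasDerivAt (fun τ => legendre g c (chartState c γ τ))
      (hamiltonianField g c (legendre g c (chartState c γ t))) t := by
  have hx := hγ.contDiffAt_chart ht hc htc
  have hy : c (γ t) ∈ c.target := c.map_source htc
  have hG : ContDiffAt ℝ ∞ (coeffForm g c) (c (γ t)) :=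
    (contDiffOn_coeffForm g hc).contDiffAt (c.open_target.mem_nhds hy)
  have hx' : ContDiffAt ℝ ∞ (deriv fun σ => c (γ σ)) t :=
    hx.derivWithin (by simp)
  have hξ : DifferentiableAt ℝ (fun τ => coeffForm g c (c (γ τ)) (deriv (fun σ => c (γ σ)) τ)) t :=
    ContDiffAt.differentiableAt (n := ∞)
      (ContDiffAt.clm_apply (ContDiffAt.comp (g := coeffForm g c) t hG hx) hx') (by simp)
  have hu := inverse_coeffForm_apply (g := g) hc hy (deriv (fun σ => c (γ σ)) t)
  refine HasDerivAt.prodMk ?_ ?_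
  · change HasDerivAt _ ((coeffForm g c (c (γ t))).inverse (coeffForm g c (c (γ t)) _)) t
    refine HasDerivAt.congr_deriv ?_ hu.symm
    exact (hx.differentiableAt (by simp)).hasDerivAt
  · refine HasDerivAt.congr_deriv hξ.hasDerivAt (Eq.symm ?_)
    refine ContinuousLinearMap.ext fun w => ?_
    have h1 := hγ.2 t ht c hc htc w
    have h2 : HasDerivAt (fun τ => coeffForm g c (c (γ τ)) (deriv (fun σ => c (γ σ)) τ) w)
        (deriv (fun τ => coeffForm g c (c (γ τ)) (deriv (fun σ => c (γ σ)) τ)) t w) t := by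
      simpa using hξ.hasDerivAt.clm_apply (hasDerivAt_const t w)
    rw [← h2.deriv]
    refine Eq.trans ?_ h1.symm
    change (1 / 2 : ℝ) • (fderiv ℝ (coeffForm g c) (c (γ t)) w
      ((coeffForm g c (c (γ t))).inverse (coeffForm g c (c (γ t)) _)))
      ((coeffForm g c (c (γ t))).inverse (coeffForm g c (c (γ t)) _)) = _
    have hu' : (coeffForm g c (c (γ t))).inverse (coeffForm g c (c (γ t)) (chartState c γ t).2) =
      deriv (fun σ => c (γ σ)) t := hu
    rw [hu', smul_eq_mul]
    congr 1
    have h3 := (hG.differentiableAt (by simp)).hasFDerivAt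
    have h4 := (h3.clm_apply (hasFDerivAt_const (deriv (fun σ => c (γ σ)) t) (c (γ t)))).clm_apply
      (hasFDerivAt_const (deriv (fun σ => c (γ σ)) t) (c (γ t)))
    change _ = fderiv ℝ (fun y => coeffForm g c y (deriv (fun σ => c (γ σ)) t)
      (deriv (fun σ => c (γ σ)) t)) (c (γ t)) w
    rw [h4.fderiv]
    simp

/-- Short time geodesic flow in a chart. -/
theorem exists_local_geodesicFlow (g : RiemMetric M) (hc : c ∈ atlas (Eucl n) M)
    {s₀ : Eucl n × Eucl n} (hs₀ : s₀.1 ∈ c.target) :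
    ∃ U ∈ 𝓝 s₀, ∃ ε > 0, ∀ τ : ℝ, |τ| < ε → ∃ φ : Eucl n × Eucl n → Eucl n × Eucl n,
      ∀ (γ : ℝ → M) (a b t : ℝ), IsGeodesicOn g γ a b → t ∈ Ioo a b → t + τ ∈ Ioo a b →
        γ t ∈ c.source → chartState c γ t ∈ U →
          γ (t + τ) ∈ c.source ∧ ContDiffAt ℝ ∞ φ (chartState c γ t) ∧
            chartState c γ (t + τ) = φ (chartState c γ t) := by
  have hΩ : IsOpen (c.target ×ˢ (univ : Set (Eucl n →L[ℝ] ℝ))) := c.open_target.prod isOpen_univ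
  have hΩ' : IsOpen (c.target ×ˢ (univ : Set (Eucl n))) := c.open_target.prod isOpen_univ
  obtain ⟨ρ, hρ, hball, ε, hε, H⟩ := exists_local_flow hΩ (contDiffOn_hamiltonianField (g := g) hc)
    (z₀ := legendre g c s₀) ⟨hs₀, mem_univ _⟩
  refine ⟨legendre g c ⁻¹' Metric.ball (legendre g c s₀) ρ,
    ((contDiffOn_legendre hc).continuousOn.continuousAt
      (hΩ'.mem_nhds ⟨hs₀, mem_univ _⟩)).preimage_mem_nhds (Metric.ball_mem_nhds _ hρ),
    ε, hε, fun τ hτ => ?_⟩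
  obtain ⟨φ, hφ, hφz⟩ := H τ hτ
  refine ⟨fun s => legendreInv g c (φ (legendre g c s)), ?_⟩
  intro γ a b t hγ ht htτ htc htU
  let ℓ : ℝ → ℝ := fun σ => t + σ * τ
  have hℓ : Continuous ℓ := by fun_prop
  have hℓmem : ∀ σ ∈ Icc (0 : ℝ) 1, ℓ σ ∈ Ioo a b := by
    intro σ hσ
    have := (convex_Ioo a b) ht htτ (sub_nonneg.2 hσ.2) hσ.1 (by ring)
    convert this using 1
    simp only [ℓ, smul_eq_mul]; ring
  let z : ℝ → Eucl n × (Eucl n →L[ℝ] ℝ) := fun σ => legendre g c (chartState c γ (ℓ σ))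
  let D : Set ℝ := {σ | γ (ℓ σ) ∈ c.source}
  have hcont : ∀ σ ∈ Icc (0 : ℝ) 1, ContinuousAt (fun σ => γ (ℓ σ)) σ := fun σ hσ =>
    ContinuousAt.comp (f := ℓ) (hγ.contMDiffAt (hℓmem σ hσ)).continuousAt hℓ.continuousAt
  have hder : ∀ σ ∈ Icc (0 : ℝ) 1, σ ∈ D → HasDerivAt z (τ • hamiltonianField g c (z σ)) σ := by
    intro σ hσ hσD
    have h1 := hγ.hasDerivAt (hℓmem σ hσ) hc hσD
    have h2 : HasDerivAt ℓ τ σ := by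
      have := ((hasDerivAt_id' σ).mul_const τ).const_add t
      rwa [one_mul] at this
    exact h1.scomp σ h2
  have key : 1 ∈ D ∧ z 1 = φ (z 0) := by
    refine hφz z D ?_ ?_ ?_ ?_
    · exact fun σ hσ hσD => ⟨(hcont σ hσ).preimage_mem_nhds (c.open_source.mem_nhds hσD),
        fun _ => hder σ hσ hσD⟩
    · let B := Metric.closedBall (legendre g c s₀) (2 * ρ)
      -- The points of `M` with coordinates in the ball form a compact set, which is closed because
      -- `M` is Hausdorff. So the geodesic cannot leave the chart domain while its coordinates stay
      -- in the ball.
      let C : Set M := c.symm '' (Prod.fst '' B)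
      have hBt : Prod.fst '' B ⊆ c.target := by
        rintro _ ⟨w, hw, rfl⟩; exact (hball hw).1
      have hC : IsClosed C := (((isCompact_closedBall _ _).image continuous_fst).image_of_continuousOn
        (c.continuousOn_symm.mono hBt)).isClosed
      have hCs : C ⊆ c.source := by
        rintro _ ⟨y, hy, rfl⟩; exact c.map_target (hBt hy)
      have hA : IsClosed (Icc (0 : ℝ) 1 ∩ (fun σ => γ (ℓ σ)) ⁻¹' C) :=
        ContinuousOn.preimage_isClosed_of_isClosed
          (fun σ hσ => (hcont σ hσ).continuousWithinAt) isClosed_Icc hC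
      have hA' := ContinuousOn.preimage_isClosed_of_isClosed (f := z) (t := B)
        (fun σ hσ => (hder σ hσ.1 (hCs hσ.2)).continuousAt.continuousWithinAt) hA
        Metric.isClosed_closedBall
      convert hA' using 1
      ext σ
      constructor
      · rintro ⟨h1, h2, h3⟩
        exact ⟨⟨h1, ⟨_, ⟨z σ, h3, rfl⟩, c.left_inv h2⟩⟩, h3⟩
      · rintro ⟨⟨h1, h2⟩, h3⟩
        exact ⟨h1, hCs h2, h3⟩
    · simpa [D, ℓ] using htc
    · simpa [z, ℓ] using htU
  obtain ⟨h1D, hz1⟩ := key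
  have h1 : ℓ 1 = t + τ := by simp [ℓ]
  have h0 : ℓ 0 = t := by simp [ℓ]
  have h1D' : γ (t + τ) ∈ c.source := by rw [← h1]; exact h1D
  have hzφ : φ (legendre g c (chartState c γ t)) = legendre g c (chartState c γ (t + τ)) := by
    have := hz1.symm
    simp only [z, h1, h0] at this
    exact this
  refine ⟨h1D', ?_, ?_⟩
  · refine ContDiffAt.comp (g := legendreInv g c) _ ?_
      (ContDiffAt.comp (g := φ) (f := legendre g c) _ hφ.contDiffAt ?_)
    · rw [hzφ]
      exact (contDiffOn_legendreInv hc).contDiffAt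
        (hΩ.mem_nhds ⟨c.map_source h1D', mem_univ _⟩)
    · exact (contDiffOn_legendre hc).contDiffAt (hΩ'.mem_nhds ⟨c.map_source htc, mem_univ _⟩)
  · beta_reduce
    rw [hzφ, legendreInv_legendre hc (c.map_source h1D')]

/-- The change of coordinates of position and velocity. -/
def stateChange (c c' : OpenPartialHomeomorph M (Eucl n)) (s : Eucl n × Eucl n) :
    Eucl n × Eucl n := (c' (c.symm s.1), fderiv ℝ (c' ∘ c.symm) s.1 s.2)

variable {c' : OpenPartialHomeomorph M (Eucl n)}

theorem contDiffAt_stateChange (hc : c ∈ atlas (Eucl n) M) (hc' : c' ∈ atlas (Eucl n) M)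
    {s : Eucl n × Eucl n} (hs : s.1 ∈ c.target) (hs' : c.symm s.1 ∈ c'.source) :
    ContDiffAt ℝ ∞ (stateChange c c') s := by
  have h := contDiffAt_coordChange hc hc' hs hs'
  exact (h.comp s contDiffAt_fst).prodMk
    (((h.fderiv_right (m := ∞) (by simp)).comp s contDiffAt_fst).clm_apply contDiffAt_snd)

theorem chartState_change (hc : c ∈ atlas (Eucl n) M) (hc' : c' ∈ atlas (Eucl n) M) {γ : ℝ → M}
    {t : ℝ} (hγ : ContMDiffAt 𝓘(ℝ, ℝ) 𝓘(ℝ, Eucl n) ∞ γ t) (htc : γ t ∈ c.source)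
    (htc' : γ t ∈ c'.source) : chartState c' γ t = stateChange c c' (chartState c γ t) := by
  have hx : DifferentiableAt ℝ (fun σ => c (γ σ)) t := by
    refine ContDiffAt.differentiableAt (n := ∞) ?_ (by simp)
    rw [← contMDiffAt_iff_contDiffAt]
    exact ((contMDiffOn_chart hc).contMDiffAt (c.open_source.mem_nhds htc)).comp t hγ
  have hcc : DifferentiableAt ℝ (c' ∘ c.symm) (c (γ t)) :=
    (contDiffAt_coordChange hc hc' (c.map_source htc)
      (by rwa [c.left_inv htc])).differentiableAt (by simp)
  refine Prod.ext (by simp [chartState, stateChange, c.left_inv htc]) ?_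
  have h1 := hcc.hasFDerivAt.comp_hasDerivAt t hx.hasDerivAt
  refine Eq.trans (Filter.EventuallyEq.deriv_eq ?_) h1.deriv
  filter_upwards [hγ.continuousAt.preimage_mem_nhds (c.open_source.mem_nhds htc)] with σ hσ
  simp [c.left_inv hσ]

/-- The position and velocity at time `t`, in the chart `c`, of the geodesics defined on `[0, 1]`
depend smoothly on the initial position and velocity near `s₀`, in the chart `i`. -/
def SmoothDependence (g : RiemMetric M) (i c : OpenPartialHomeomorph M (Eucl n))
    (s₀ : Eucl n × Eucl n) (t : ℝ) : Prop :=
  ∃ Ψ : Eucl n × Eucl n → Eucl n × Eucl n, ContDiffAt ℝ ∞ Ψ s₀ ∧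
    ∀ᶠ s in 𝓝 s₀, ∀ (γ : ℝ → M) (a b : ℝ), a < 0 → 1 < b → IsGeodesicOn g γ a b →
      γ 0 ∈ i.source → chartState i γ 0 = s → γ t ∈ c.source ∧ chartState c γ t = Ψ s

variable {i : OpenPartialHomeomorph M (Eucl n)} {γ₀ : ℝ → M} {a₀ b₀ : ℝ}

/-- By continuity of `Ψ`, geodesics that start near `γ₀` are at time `t` still in the domain of the
new chart, where a smooth change of coordinates applies. -/
theorem SmoothDependence.change {t : ℝ} (h : SmoothDependence g i c (chartState i γ₀ 0) t)
    (hc : c ∈ atlas (Eucl n) M) (hc' : c' ∈ atlas (Eucl n) M) (ht : t ∈ Icc (0 : ℝ) 1)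
    (ha : a₀ < 0) (hb : 1 < b₀) (hγ₀ : IsGeodesicOn g γ₀ a₀ b₀) (h0 : γ₀ 0 ∈ i.source)
    (htc' : γ₀ t ∈ c'.source) : SmoothDependence g i c' (chartState i γ₀ 0) t := by
  obtain ⟨Ψ, hΨ, hev⟩ := h
  obtain ⟨htc, hΨ0⟩ := hev.self_of_nhds γ₀ a₀ b₀ ha hb hγ₀ h0 rfl
  have h1 : (Ψ (chartState i γ₀ 0)).1 ∈ c.target := by
    rw [← hΨ0]; exact c.map_source htc
  have h2 : c.symm (Ψ (chartState i γ₀ 0)).1 ∈ c'.source := by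
    rw [← hΨ0]
    change c.symm (c (γ₀ t)) ∈ _
    rwa [c.left_inv htc]
  refine ⟨fun s => stateChange c c' (Ψ s), (contDiffAt_stateChange hc hc' h1 h2).comp _ hΨ, ?_⟩
  have hopen := c.symm.isOpen_inter_preimage c'.open_source
  have hcont : ContinuousAt (fun s => (Ψ s).1) (chartState i γ₀ 0) :=
    continuous_fst.continuousAt.comp hΨ.continuousAt
  filter_upwards [hev, hcont.preimage_mem_nhds (hopen.mem_nhds ⟨h1, h2⟩)] with s hs hsΨ
  intro γ a b ha hb hγ hγ0 hγs
  obtain ⟨h3, h4⟩ := hs γ a b ha hb hγ hγ0 hγs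
  have h5 : γ t ∈ c'.source := by
    have h6 : c.symm (Ψ s).1 ∈ c'.source := hsΨ.2
    rw [← h4] at h6
    change c.symm (c (γ t)) ∈ _ at h6
    rwa [c.left_inv h3] at h6
  exact ⟨h5, by
    rw [← h4]
    exact chartState_change hc hc' (hγ.contMDiffAt ⟨ha.trans_le ht.1, ht.2.trans_lt hb⟩) h3 h5⟩

theorem SmoothDependence.step {U : Set (Eucl n × Eucl n)} {t t' : ℝ}
    {φ : Eucl n × Eucl n → Eucl n × Eucl n}
    (hφ : ∀ (γ : ℝ → M) (a b : ℝ), IsGeodesicOn g γ a b → t ∈ Ioo a b → t' ∈ Ioo a b →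
        γ t ∈ c.source → chartState c γ t ∈ U →
          γ t' ∈ c.source ∧ ContDiffAt ℝ ∞ φ (chartState c γ t) ∧
            chartState c γ t' = φ (chartState c γ t))
    (h : SmoothDependence g i c (chartState i γ₀ 0) t)
    (ht : t ∈ Icc (0 : ℝ) 1) (ht' : t' ∈ Icc (0 : ℝ) 1)
    (ha : a₀ < 0) (hb : 1 < b₀) (hγ₀ : IsGeodesicOn g γ₀ a₀ b₀) (h0 : γ₀ 0 ∈ i.source)
    (hU : U ∈ 𝓝 (chartState c γ₀ t)) : SmoothDependence g i c (chartState i γ₀ 0) t' := by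
  obtain ⟨Ψ, hΨ, hev⟩ := h
  obtain ⟨htc, hΨ0⟩ := hev.self_of_nhds γ₀ a₀ b₀ ha hb hγ₀ h0 rfl
  have hI : ∀ {a b s : ℝ}, a < 0 → 1 < b → s ∈ Icc (0 : ℝ) 1 → s ∈ Ioo a b :=
    fun ha hb hs => ⟨ha.trans_le hs.1, hs.2.trans_lt hb⟩
  have hφ0 := hφ γ₀ a₀ b₀ hγ₀ (hI ha hb ht) (hI ha hb ht') htc (mem_of_mem_nhds hU)
  rw [hΨ0] at hφ0 hU
  refine ⟨φ ∘ Ψ, hφ0.2.1.comp _ hΨ, ?_⟩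
  filter_upwards [hev, hΨ.continuousAt.preimage_mem_nhds hU] with s hs hsU
  intro γ a b ha hb hγ hγ0 hγs
  obtain ⟨h3, h4⟩ := hs γ a b ha hb hγ hγ0 hγs
  have h5 := hφ γ a b hγ (hI ha hb ht) (hI ha hb ht') h3 (by rw [h4]; exact hsU)
  exact ⟨h5.1, by rw [h5.2.2, h4]; rfl⟩

/-- The momentum is differentiable, hence continuous, and the inverse Legendre transformation
recovers the velocity. -/
theorem IsGeodesicOn.continuousAt_chartState {γ : ℝ → M} {a b t : ℝ} (hγ : IsGeodesicOn g γ a b)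
    (ht : t ∈ Ioo a b) (hc : c ∈ atlas (Eucl n) M) (htc : γ t ∈ c.source) :
    ContinuousAt (chartState c γ) t := by
  have h1 := (hγ.hasDerivAt ht hc htc).continuousAt
  have h2 : ContinuousAt (legendreInv g c) (legendre g c (chartState c γ t)) :=
    ((contDiffOn_legendreInv hc).contDiffAt ((c.open_target.prod isOpen_univ).mem_nhds
      ⟨c.map_source htc, mem_univ _⟩)).continuousAt
  refine (ContinuousAt.comp (g := legendreInv g c)
    (f := fun τ => legendre g c (chartState c γ τ)) h2 h1).congr ?_
  filter_upwards [(hγ.contMDiffAt ht).continuousAt.preimage_mem_nhds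
    (c.open_source.mem_nhds htc)] with σ hσ
  exact legendreInv_legendre hc (c.map_source hσ)

/-- Connectedness of `[0, 1]`: smooth dependence passes between nearby times in both directions,
since the local flow exists for `τ` of either sign. -/
theorem smoothDependence_geodesic (hi : i ∈ atlas (Eucl n) M) (ha : a₀ < 0) (hb : 1 < b₀)
    (hγ₀ : IsGeodesicOn g γ₀ a₀ b₀) (h0 : γ₀ 0 ∈ i.source) {t : ℝ} (ht : t ∈ Icc (0 : ℝ) 1)
    (hc : c ∈ atlas (Eucl n) M) (htc : γ₀ t ∈ c.source) :
    SmoothDependence g i c (chartState i γ₀ 0) t := by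
  have hI : ∀ {s : ℝ}, s ∈ Icc (0 : ℝ) 1 → s ∈ Ioo a₀ b₀ :=
    fun hs => ⟨ha.trans_le hs.1, hs.2.trans_lt hb⟩
  let Q : ℝ → Prop := fun t => ∀ c ∈ atlas (Eucl n) M, γ₀ t ∈ c.source →
    SmoothDependence g i c (chartState i γ₀ 0) t
  have hQ0 : Q 0 := by
    have : SmoothDependence g i i (chartState i γ₀ 0) 0 :=
      ⟨id, contDiffAt_id, Filter.Eventually.of_forall fun s γ a b _ _ _ h1 h2 => ⟨h1, h2⟩⟩
    exact fun c hc hcs => this.change hi hc ⟨le_rfl, zero_le_one⟩ ha hb hγ₀ h0 hcs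
  refine isPreconnected_Icc.induction₂' (s := Icc (0 : ℝ) 1) (fun x y => Q x → Q y) ?_ ?_
    ⟨le_rfl, zero_le_one⟩ ht hQ0 c hc htc
  · intro t₀ ht₀
    let k := chartAt (Eucl n) (γ₀ t₀)
    have hk : k ∈ atlas (Eucl n) M := chart_mem_atlas _ _
    have ht₀k : γ₀ t₀ ∈ k.source := mem_chart_source _ _
    obtain ⟨U, hU, ε, hε, H⟩ := exists_local_geodesicFlow g hk (s₀ := chartState k γ₀ t₀)
      (k.map_source ht₀k)
    have e1 : ∀ᶠ t in 𝓝[Icc 0 1] t₀, γ₀ t ∈ k.source := nhdsWithin_le_nhds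
      ((hγ₀.contMDiffAt (hI ht₀)).continuousAt.preimage_mem_nhds (k.open_source.mem_nhds ht₀k))
    -- The backward step starts at time `t` and needs `U` to be a neighbourhood of the state there,
    -- hence the interior.
    have e2 : ∀ᶠ t in 𝓝[Icc 0 1] t₀, chartState k γ₀ t ∈ interior U := nhdsWithin_le_nhds
      ((hγ₀.continuousAt_chartState (hI ht₀) hk ht₀k).preimage_mem_nhds (interior_mem_nhds.2 hU))
    have e3 : ∀ᶠ t in 𝓝[Icc 0 1] t₀, |t - t₀| < ε :=
      nhdsWithin_le_nhds (Metric.ball_mem_nhds t₀ hε)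
    filter_upwards [e1, e2, e3, self_mem_nhdsWithin] with t ht1 ht2 ht3 ht4
    constructor
    · intro hQ c hc htc
      obtain ⟨φ, hφ⟩ := H (t - t₀) ht3
      have := SmoothDependence.step (t := t₀) (t' := t) (U := U) (φ := φ)
        (fun γ a b h1 h2 h3 => by
          have := hφ γ a b t₀ h1 h2
          rw [add_sub_cancel] at this
          exact this h3) (hQ k hk ht₀k) ht₀ ht4 ha hb hγ₀ h0 hU
      exact this.change hk hc ht4 ha hb hγ₀ h0 htc
    · intro hQ c hc htc
      obtain ⟨φ, hφ⟩ := H (t₀ - t) (by rwa [abs_sub_comm])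
      have := SmoothDependence.step (t := t) (t' := t₀) (U := U) (φ := φ)
        (fun γ a b h1 h2 h3 => by
          have := hφ γ a b t h1 h2
          rw [add_sub_cancel] at this
          exact this h3) (hQ k hk ht1) ht4 ht₀ ha hb hγ₀ h0 (mem_interior_iff_mem_nhds.1 ht2)
      exact this.change hk hc ht₀ ha hb hγ₀ h0 htc
  · exact fun x y z _ _ _ h1 h2 h => h2 (h1 h)

end Geodesic

/-! ### The exponential map -/

section Exp

variable {n : ℕ} {M : Man n} {g : RiemMetric M}

theorem tangentChange_eq_fderiv (i j : atlas (Eucl n) M) (p : M) :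
    tangentChange M i j p = fderiv ℝ (j.1 ∘ i.1.symm) (i.1 p) := by
  simp only [tangentChange, tangentBundleCore_coordChange, mfld_simps, fderivWithin_univ]

theorem tangentChange_tangentChange (i j : atlas (Eucl n) M) {p : M} (hi : p ∈ i.1.source)
    (hj : p ∈ j.1.source) (w : Eucl n) :
    tangentChange M j i p (tangentChange M i j p w) = w := by
  rw [(tangentBundleCore 𝓘(ℝ, Eucl n) M).coordChange_comp i j i p ⟨⟨hi, hj⟩, hi⟩,
    (tangentBundleCore 𝓘(ℝ, Eucl n) M).coordChange_self i p hi]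

/-- A tangent vector at `p` is by definition its coordinate vector in the preferred chart at `p`. -/
theorem chartState_preferred {γ : ℝ → M} {p : M} {v : Eucl n}
    (hγ : ContMDiffAt 𝓘(ℝ, ℝ) 𝓘(ℝ, Eucl n) ∞ γ 0)
    (h : (⟨γ 0, mfderiv 𝓘(ℝ, ℝ) 𝓘(ℝ, Eucl n) γ 0 (1 : ℝ)⟩ : TangentBundle 𝓘(ℝ, Eucl n) M) =
      ⟨p, v⟩) : γ 0 = p ∧ chartState (chartAt (Eucl n) p) γ 0 = (chartAt (Eucl n) p p, v) := by
  have hp : γ 0 = p := congrArg Bundle.TotalSpace.proj h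
  subst hp
  have hv : mfderiv 𝓘(ℝ, ℝ) 𝓘(ℝ, Eucl n) γ 0 (1 : ℝ) = v := by
    injection h with h1 h2
  refine ⟨rfl, Prod.ext rfl ?_⟩
  rw [← hv, (hγ.mdifferentiableAt (by simp)).mfderiv]
  simp only [mfld_simps, fderivWithin_univ]
  rfl

theorem chartState_initial (i : atlas (Eucl n) M) {γ : ℝ → M} {p : M} (hp : p ∈ i.1.source)
    {w : Eucl n} (hγ : ContMDiffAt 𝓘(ℝ, ℝ) 𝓘(ℝ, Eucl n) ∞ γ 0)
    (h : (⟨γ 0, mfderiv 𝓘(ℝ, ℝ) 𝓘(ℝ, Eucl n) γ 0 (1 : ℝ)⟩ : TangentBundle 𝓘(ℝ, Eucl n) M) =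
      ⟨p, tangentChange M i (achart (Eucl n) p) p w⟩) :
    γ 0 = p ∧ chartState i.1 γ 0 = (i.1 p, w) := by
  obtain ⟨h0, h1⟩ := chartState_preferred hγ h
  refine ⟨h0, ?_⟩
  have hps := mem_chart_source (Eucl n) p
  rw [chartState_change (chart_mem_atlas (Eucl n) p) i.2 hγ (by rwa [h0]) (by rwa [h0]), h1,
    stateChange]
  refine Prod.ext (by simp [(chartAt (Eucl n) p).left_inv hps]) ?_
  have := tangentChange_tangentChange i (achart (Eucl n) p) hp hps w
  rw [tangentChange_eq_fderiv (achart (Eucl n) p) i p] at this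
  exact this

theorem isExp_expMap {p : M} {v : Eucl n} (h : ∃ q, IsExp g p v q) :
    IsExp g p v (expMap g p v) := by
  rw [expMap, dif_pos h]
  exact h.choose_spec

/-- Smooth dependence of the exponential map on the base point and the vector. -/
theorem exists_contDiffAt_exp (i : atlas (Eucl n) M) {p₀ : M} (hp₀ : p₀ ∈ i.1.source)
    {w₀ : Eucl n} {q₀ : M}
    (h₀ : IsExp g p₀ (tangentChange M i (achart (Eucl n) p₀) p₀ w₀) q₀)
    {c : OpenPartialHomeomorph M (Eucl n)} (hc : c ∈ atlas (Eucl n) M) (hq₀ : q₀ ∈ c.source) :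
    ∃ Ψ : Eucl n × Eucl n → Eucl n, ContDiffAt ℝ ∞ Ψ (i.1 p₀, w₀) ∧
      ∀ᶠ s in 𝓝 (i.1 p₀, w₀), ∀ p ∈ i.1.source, i.1 p = s.1 → ∀ q,
        IsExp g p (tangentChange M i (achart (Eucl n) p) p s.2) q → q ∈ c.source ∧ c q = Ψ s := by
  obtain ⟨a, ha, b, hb, γ, hγ, hinit, rfl⟩ := h₀
  have hI : ∀ {a b : ℝ}, a < 0 → 1 < b → (0 : ℝ) ∈ Ioo a b :=
    fun ha hb => ⟨ha, zero_lt_one.trans hb⟩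
  obtain ⟨h0, hs⟩ := chartState_initial i hp₀ (hγ.contMDiffAt (hI ha hb)) hinit
  obtain ⟨Ψ, hΨ, hev⟩ := smoothDependence_geodesic i.2 ha hb hγ (by rwa [h0])
    ⟨zero_le_one, le_rfl⟩ hc hq₀
  rw [hs] at hΨ hev
  refine ⟨fun s => (Ψ s).1, contDiffAt_fst.comp _ hΨ, ?_⟩
  filter_upwards [hev] with s hs p hp hps q hq
  obtain ⟨a, ha, b, hb, γ, hγ, hinit, rfl⟩ := hq
  obtain ⟨h0, hs'⟩ := chartState_initial i hp (hγ.contMDiffAt (hI ha hb)) hinit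
  obtain ⟨h1, h2⟩ := hs γ a b ha hb hγ (by rwa [h0]) (by rw [hs', hps])
  exact ⟨h1, by rw [← h2]; rfl⟩

/-- Both end points have their coordinates given by the same function `Ψ` of the same initial data.
This makes the choice in `expMap` harmless. -/
theorem IsExp.unique {p : M} {v : Eucl n} {q q' : M} (h : IsExp g p v q) (h' : IsExp g p v q') :
    q = q' := by
  let i := achart (Eucl n) p
  have hp : p ∈ i.1.source := mem_chart_source (Eucl n) p
  have hv : tangentChange M i (achart (Eucl n) p) p v = v :=
    (tangentBundleCore 𝓘(ℝ, Eucl n) M).coordChange_self i p hp v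
  have hq := mem_chart_source (Eucl n) q
  rw [← hv] at h h'
  obtain ⟨Ψ, -, hev⟩ := exists_contDiffAt_exp i hp h (chart_mem_atlas (Eucl n) q) hq
  have H := hev.self_of_nhds p hp rfl
  obtain ⟨-, h2⟩ := H q h
  obtain ⟨h3, h4⟩ := H q' h'
  exact (chartAt (Eucl n) q).injOn hq h3 (h2.trans h4.symm)

theorem isExp_zero (p : M) : IsExp g p (0 : Eucl n) p := by
  refine ⟨-1, by norm_num, 2, by norm_num, fun _ => p, ⟨contMDiffOn_const, ?_⟩, ?_, rfl⟩
  · intro t _ c _ _ w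
    have h : ∀ y w : Eucl n, coeff g c y 0 w = 0 := fun y w => by
      rw [← coeffForm_apply]; simp
    simp [h]
  · rw [mfderiv_const]
    rfl

theorem expMap_zero (p : M) : expMap g p (0 : Eucl n) = p :=
  (isExp_expMap ⟨p, isExp_zero p⟩).unique (isExp_zero p)

/-- The range of `θ_t` is a ball about `0`, so it contains `0`, and `exp_p(0) = p`. This is what
makes the scanning embeddings a cover. -/
theorem mem_range_expTheta (θ : BallFamily n) (r : C(M, Ioi (0 : ℝ)))
    (hr : IsInjectivityRadius g r) (p : M) : p ∈ range (fn (expTheta θ g r hr p)) := by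
  have h0 : (0 : Eucl n) ∈ range (fn (θ.theta (r p))) := by
    rw [θ.range_eq]
    exact Metric.mem_ball_self (r p).2
  obtain ⟨v, hv⟩ := h0
  refine ⟨frame g p v, ?_⟩
  change expMap g p (frame g p (fn (θ.theta (r p)) ((frame g p).symm (frame g p v)))) = p
  rw [ContinuousLinearEquiv.symm_apply_apply, hv, map_zero, expMap_zero]

end Exp

/-! ### Convergence of families of maps with all derivatives -/

section SmoothTendsto

open Filter

variable {P : Type*} {E F G : Type*} [NormedAddCommGroup E] [NormedSpace ℝ E]
  [NormedAddCommGroup F] [NormedSpace ℝ F] [NormedAddCommGroup G] [NormedSpace ℝ G]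

/-- The maps `f p` converge to `f₀` along the filter `l`, with all derivatives and locally uniformly
near `x`. -/
structure SmoothTendsto (l : Filter P) (f : P → E → F) (f₀ : E → F) (x : E) : Prop where
  contDiffAt : ContDiffAt ℝ ∞ f₀ x
  eventually : ∀ k : ℕ, ∀ᶠ q in l ×ˢ 𝓝 x, ContDiffAt ℝ k (f q.1) q.2
  tendsto : ∀ k : ℕ, Tendsto (fun q : P × E => iteratedFDeriv ℝ k (f q.1) q.2) (l ×ˢ 𝓝 x)
    (𝓝 (iteratedFDeriv ℝ k f₀ x))

variable {l : Filter P}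

theorem tendsto_clm_apply {ι : Type*} {m : Filter ι} {A : ι → E →L[ℝ] F} {v : ι → E}
    {A₀ : E →L[ℝ] F} {v₀ : E} (hA : Tendsto A m (𝓝 A₀)) (hv : Tendsto v m (𝓝 v₀)) :
    Tendsto (fun i => A i (v i)) m (𝓝 (A₀ v₀)) :=
  (isBoundedBilinearMap_apply.continuous.tendsto (A₀, v₀)).comp (hA.prodMk_nhds hv)

theorem tendsto_iteratedFDeriv_zero_iff {ι : Type*} {m : Filter ι} {f : ι → E → F} {y : ι → E}
    {f₀ : E → F} {x : E} : Tendsto (fun q => iteratedFDeriv ℝ 0 (f q) (y q)) m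
      (𝓝 (iteratedFDeriv ℝ 0 f₀ x)) ↔ Tendsto (fun q => f q (y q)) m (𝓝 (f₀ x)) := by
  have h := (continuousMultilinearCurryFin0 ℝ E F).symm.toHomeomorph.isEmbedding.tendsto_nhds_iff
    (f := fun q => f q (y q)) (l := m) (y := f₀ x)
  exact h.symm

theorem SmoothTendsto.tendsto_apply {f : P → E → F} {f₀ : E → F} {x : E}
    (h : SmoothTendsto l f f₀ x) : Tendsto (fun q : P × E => f q.1 q.2) (l ×ˢ 𝓝 x) (𝓝 (f₀ x)) :=
  tendsto_iteratedFDeriv_zero_iff.1 (h.tendsto 0)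

theorem smoothTendsto_const {f : E → F} {x : E} (h : ContDiffAt ℝ ∞ f x) :
    SmoothTendsto l (fun _ => f) f x where
  contDiffAt := h
  eventually k := tendsto_snd.eventually ((h.of_le (by exact_mod_cast le_top)).eventually (by simp))
  tendsto k := (h.continuousAt_iteratedFDeriv (by exact_mod_cast le_top)).tendsto.comp tendsto_snd

/-- By the Faà di Bruno formula, derivatives of a composition are polynomial in those of the
factors, so convergence of the latter passes to the former. -/
theorem SmoothTendsto.comp {g : P → F → G} {g₀ : F → G} {f : P → E → F} {f₀ : E → F} {x : E}
    (hg : SmoothTendsto l g g₀ (f₀ x)) (hf : SmoothTendsto l f f₀ x) :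
    SmoothTendsto l (fun p y => g p (f p y)) (fun y => g₀ (f₀ y)) x := by
  have hT : Tendsto (fun q : P × E => (q.1, f q.1 q.2)) (l ×ˢ 𝓝 x) (l ×ˢ 𝓝 (f₀ x)) :=
    tendsto_fst.prodMk hf.tendsto_apply
  refine ⟨hg.contDiffAt.comp x hf.contDiffAt, fun k => ?_, fun k => ?_⟩
  · filter_upwards [hf.eventually k, hT.eventually (hg.eventually k)] with q h1 h2
    exact h2.comp q.2 h1
  · have hle : (k : WithTop ℕ∞) ≤ ∞ := by exact_mod_cast le_top
    have h1 : (fun q : P × E => iteratedFDeriv ℝ k (fun y => g q.1 (f q.1 y)) q.2) =ᶠ[l ×ˢ 𝓝 x]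
        fun q => (ftaylorSeries ℝ (g q.1) (f q.1 q.2)).taylorComp (ftaylorSeries ℝ (f q.1) q.2) k := by
      filter_upwards [hf.eventually k, hT.eventually (hg.eventually k)] with q h1 h2
      exact iteratedFDeriv_comp h2 h1 le_rfl
    refine Tendsto.congr' h1.symm ?_
    rw [show iteratedFDeriv ℝ k (fun y => g₀ (f₀ y)) x = _ from
      iteratedFDeriv_comp (hg.contDiffAt.of_le hle) (hf.contDiffAt.of_le hle) le_rfl]
    rw [tendsto_iff_norm_sub_tendsto_zero, ← tendsto_zero_iff_norm_tendsto_zero]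
    have hgT := fun j => (hg.tendsto j).comp hT
    have hlo := FormalMultilinearSeries.taylorComp_sub_taylorComp_isLittleO (n := k)
      (l := l ×ˢ 𝓝 x) (f := fun _ => (1 : ℝ))
      (p₁ := fun q : P × E => ftaylorSeries ℝ (g q.1) (f q.1 q.2))
      (p₂ := fun _ => ftaylorSeries ℝ g₀ (f₀ x))
      (q₁ := fun q : P × E => ftaylorSeries ℝ (f q.1) q.2) (q₂ := fun _ => ftaylorSeries ℝ f₀ x)
      (fun j _ => (hgT j).norm.isBoundedUnder_le)
      (fun j _ => (Asymptotics.isLittleO_one_iff ℝ).2 (by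
        simpa [ftaylorSeries] using (hgT j).sub_const (iteratedFDeriv ℝ j g₀ (f₀ x))))
      (fun j _ => (hf.tendsto j).norm.isBoundedUnder_le)
      (fun j _ => isBoundedUnder_const)
      (fun j _ => (Asymptotics.isLittleO_one_iff ℝ).2 (by
        simpa [ftaylorSeries] using (hf.tendsto j).sub_const (iteratedFDeriv ℝ j f₀ x)))
    exact (Asymptotics.isLittleO_one_iff ℝ).1 hlo

theorem SmoothTendsto.congr {f f' : P → E → F} {f₀ f₀' : E → F} {x : E}
    (h : SmoothTendsto l f f₀ x) (hf : ∀ᶠ q in l ×ˢ 𝓝 x, f q.1 =ᶠ[𝓝 q.2] f' q.1)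
    (h₀ : f₀ =ᶠ[𝓝 x] f₀') : SmoothTendsto l f' f₀' x := by
  refine ⟨h.contDiffAt.congr_of_eventuallyEq h₀.symm, fun k => ?_, fun k => ?_⟩
  · filter_upwards [hf, h.eventually k] with q h1 h2 using h2.congr_of_eventuallyEq h1.symm
  · rw [← (h₀.iteratedFDeriv ℝ k).eq_of_nhds]
    refine (h.tendsto k).congr' ?_
    filter_upwards [hf] with q h1 using (h1.iteratedFDeriv ℝ k).eq_of_nhds

theorem smoothTendsto_affine {a : P → F} {a₀ : F} {L : P → E →L[ℝ] F} {L₀ : E →L[ℝ] F}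
    (ha : Tendsto a l (𝓝 a₀)) (hL : Tendsto L l (𝓝 L₀)) (x : E) :
    SmoothTendsto l (fun p y => a p + L p y) (fun y => a₀ + L₀ y) x := by
  refine ⟨contDiffAt_const.add L₀.contDiff.contDiffAt,
    fun k => Eventually.of_forall fun q => contDiffAt_const.add (L q.1).contDiff.contDiffAt,
    fun k => ?_⟩
  have hL1 : Tendsto (fun q : P × E => L q.1) (l ×ˢ 𝓝 x) (𝓝 L₀) := hL.comp tendsto_fst
  cases k with
  | zero =>
    exact tendsto_iteratedFDeriv_zero_iff.2
      ((ha.comp tendsto_fst).add (tendsto_clm_apply hL1 tendsto_snd))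
  | succ k =>
    have hd : ∀ (b : F) (T : E →L[ℝ] F), fderiv ℝ (fun y => b + T y) = fun _ => T :=
      fun b T => funext fun y => by rw [fderiv_const_add, T.fderiv]
    simp only [iteratedFDeriv_succ_eq_comp_right, hd, Function.comp_apply]
    refine (LinearIsometryEquiv.continuous _).continuousAt.tendsto.comp ?_
    cases k with
    | zero => exact tendsto_iteratedFDeriv_zero_iff.2 hL1
    | succ k =>
      simp only [iteratedFDeriv_succ_const]
      exact tendsto_const_nhds

theorem smoothTendsto_linear {L : P → E →L[ℝ] F} {L₀ : E →L[ℝ] F}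
    (hL : Tendsto L l (𝓝 L₀)) (x : E) :
    SmoothTendsto l (fun p y => L p y) (fun y => L₀ y) x := by
  simpa using smoothTendsto_affine (tendsto_const_nhds (x := (0 : F))) hL x

end SmoothTendsto

/-! ### The topology on spaces of embeddings of `ℝⁿ` -/

section Emb

open Filter

variable {n : ℕ} {P : Type*} {l : Filter P}

theorem contDiff_fn (f : Rn n ⟶ Rn n) : ContDiff ℝ ∞ (fn f : Eucl n → Eucl n) := by
  rw [← contMDiff_iff_contDiff]
  exact (fn_isLocalDiffeomorph f).contMDiff

/-- Convergence in the space of open embeddings of `ℝⁿ` implies convergence of all derivatives. -/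
theorem smoothTendsto_of_tendsto {f : P → (Rn n ⟶ Rn n)} {f₀ : Rn n ⟶ Rn n}
    (h : Tendsto f l (𝓝 f₀)) (x : Eucl n) :
    SmoothTendsto l (fun p => (fn (f p) : Eucl n → Eucl n)) (fn f₀) x := by
  refine ⟨(contDiff_fn f₀).contDiffAt, fun k => Eventually.of_forall fun q =>
    ((contDiff_fn (f q.1)).of_le (by exact_mod_cast le_top)).contDiffAt, fun k => ?_⟩
  rw [tendsto_nhds]
  intro O hO hxO
  have hc : Continuous (iteratedFDeriv ℝ k (fn f₀ : Eucl n → Eucl n)) :=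
    (contDiff_fn f₀).continuous_iteratedFDeriv (by exact_mod_cast le_top)
  obtain ⟨K, hK, hxK, hKO⟩ := exists_compact_subset (hO.preimage hc) hxO
  let R : OpenPartialHomeomorph (Rn n) (Eucl n) := OpenPartialHomeomorph.refl (Eucl n)
  have hR : R ∈ atlas (Eucl n) (Rn n) := rfl
  have hopen : IsOpen (subbasicSet (Rn n) (Rn n) R R K k O) :=
    TopologicalSpace.isOpen_generateFrom_of_mem
      ⟨R, hR, R, hR, K, hK, subset_univ _, k, O, hO, rfl⟩
  have hmem : f₀ ∈ subbasicSet (Rn n) (Rn n) R R K k O :=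
    ⟨fun _ _ => mem_univ _, fun y hy => hKO hy⟩
  filter_upwards [(h.eventually (hopen.mem_nhds hmem)).prod_mk
    (mem_of_superset (isOpen_interior.mem_nhds hxK) interior_subset : K ∈ 𝓝 x)] with q hq
  exact hq.1.2 q.2 hq.2

/-- A criterion for convergence in the space of open embeddings `ℝⁿ → M`. -/
theorem tendsto_of_smoothTendsto {M : Man n} {f : P → (Rn n ⟶ M)} {f₀ : Rn n ⟶ M}
    (h : ∀ x : Eucl n, ∀ c ∈ atlas (Eucl n) M, fn f₀ x ∈ c.source →
      (∀ᶠ q in l ×ˢ 𝓝 x, fn (f q.1) q.2 ∈ c.source) ∧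
        SmoothTendsto l (fun p y => c (fn (f p) y)) (fun y => c (fn f₀ y)) x) :
    Tendsto f l (𝓝 f₀) := by
  rw [TopologicalSpace.tendsto_nhds_generateFrom_iff]
  rintro W ⟨R, hR, c, hc, K, hK, -, k, O, hO, rfl⟩ ⟨hmaps, hd⟩
  obtain rfl : R = OpenPartialHomeomorph.refl (Eucl n) := hR
  have h1 : ∀ x ∈ K, {q : P × Eucl n | fn (f q.1) q.2 ∈ c.source ∧
      iteratedFDeriv ℝ k (fun y => c (fn (f q.1) y)) q.2 ∈ O} ∈ l ×ˢ 𝓝 x := fun x hx => by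
    obtain ⟨h2, h3⟩ := h x c hc (hmaps hx)
    exact h2.and ((h3.tendsto k).eventually (hO.mem_nhds (hd x hx)))
  -- Compactness of `K` merges the neighbourhoods at its points into one set of parameters that
  -- works on all of `K`.
  have h2 := hK.mem_prod_nhdsSet_of_forall h1
  obtain ⟨A, hA, B, hB, hAB⟩ := Filter.mem_prod_iff.1 h2
  filter_upwards [hA] with p hp
  have hKB := subset_of_mem_nhdsSet hB
  exact ⟨fun x hx => (hAB (mk_mem_prod hp (hKB hx))).1,
    fun x hx => (hAB (mk_mem_prod hp (hKB hx))).2⟩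

end Emb

/-! ### Continuity of the scanning embeddings in the base point -/

/-- The constant is the minimum of the quadratic form on the unit sphere. -/
theorem exists_pos_le_of_posDef {E : Type*} [NormedAddCommGroup E] [NormedSpace ℝ E]
    [FiniteDimensional ℝ E] (B : E →L[ℝ] E →L[ℝ] ℝ) (hB : ∀ u ≠ 0, 0 < B u u) :
    ∃ m > 0, ∀ u, m * ‖u‖ ^ 2 ≤ B u u := by
  rcases subsingleton_or_nontrivial E with h | h
  · exact ⟨1, one_pos, fun u => by simp [Subsingleton.elim u 0]⟩
  have hne : (Metric.sphere (0 : E) 1).Nonempty := (NormedSpace.sphere_nonempty (x := (0 : E))).2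
    zero_le_one
  obtain ⟨u₀, hu₀, hmin⟩ := (isCompact_sphere (0 : E) 1).exists_isMinOn hne
    (f := fun u => B u u) (by fun_prop)
  have hu₀' : u₀ ≠ 0 := by
    rintro rfl
    simp at hu₀
  refine ⟨B u₀ u₀, hB u₀ hu₀', fun u => ?_⟩
  rcases eq_or_ne u 0 with rfl | hu
  · simp
  have hn : ‖u‖ ≠ 0 := norm_ne_zero_iff.2 hu
  have h1 : B u₀ u₀ ≤ B (‖u‖⁻¹ • u) (‖u‖⁻¹ • u) := hmin (by
    rw [mem_sphere_zero_iff_norm, norm_smul, norm_inv, norm_norm, inv_mul_cancel₀ hn])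
  simp only [map_smul, smul_apply, smul_eq_mul] at h1
  calc B u₀ u₀ * ‖u‖ ^ 2 ≤ (‖u‖⁻¹ * (‖u‖⁻¹ * B u u)) * ‖u‖ ^ 2 := by gcongr
    _ = B u u := by field_simp

section Frames

open Filter

variable {n : ℕ} {M : Man n} {g : RiemMetric M}

theorem exists_norm_le_of_isometric (g : RiemMetric M) {c : OpenPartialHomeomorph M (Eucl n)}
    (hc : c ∈ atlas (Eucl n) M) {p₀ : M} (hp₀ : p₀ ∈ c.source) :
    ∃ C, ∀ᶠ p in 𝓝 p₀, ∀ T : Eucl n →L[ℝ] Eucl n,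
      (∀ v w, coeff g c (c p) (T v) (T w) = ⟪v, w⟫_ℝ) → ‖T‖ ≤ C := by
  have hy₀ := c.map_source hp₀
  obtain ⟨m, hm, hB⟩ := exists_pos_le_of_posDef (coeffForm g c (c p₀))
    (fun u hu => coeff_pos g hc hy₀ hu)
  have hcont : ContinuousAt (fun p => coeffForm g c (c p)) p₀ :=
    ContinuousAt.comp (g := coeffForm g c)
      ((contDiffOn_coeffForm g hc).continuousOn.continuousAt (c.open_target.mem_nhds hy₀))
      (c.continuousAt hp₀)
  -- Near `p₀` the metric differs by less than `m / 2` from its value at `p₀`, which is at least `m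
  -- ‖u‖²`; so `m / 2 * ‖T v‖² ≤ ‖v‖²`.
  refine ⟨√(2 / m), ?_⟩
  filter_upwards [hcont.preimage_mem_nhds (Metric.ball_mem_nhds _ (half_pos hm))] with p hp T hT
  refine T.opNorm_le_bound (by positivity) fun v => ?_
  have h1 : ‖coeffForm g c (c p) - coeffForm g c (c p₀)‖ < m / 2 := by
    rw [← dist_eq_norm]; exact hp
  have h2 : coeffForm g c (c p) (T v) (T v) = ‖v‖ ^ 2 := by
    rw [← real_inner_self_eq_norm_sq]; exact hT v v
  have h3 := hB (T v)
  have h4 : |(coeffForm g c (c p) - coeffForm g c (c p₀)) (T v) (T v)| ≤ m / 2 * ‖T v‖ * ‖T v‖ := by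
    rw [← Real.norm_eq_abs]
    refine (ContinuousLinearMap.le_opNorm₂ _ _ _).trans ?_
    gcongr
  have h5 : m / 2 * ‖T v‖ ^ 2 ≤ ‖v‖ ^ 2 := by
    simp only [sub_apply, h2] at h4
    have := (abs_le.1 h4).1
    nlinarith
  refine abs_le_of_sq_le_sq' ?_ (by positivity) |>.2
  rw [mul_pow, Real.sq_sqrt (by positivity)]
  calc ‖T v‖ ^ 2 = 2 / m * (m / 2 * ‖T v‖ ^ 2) := by field_simp
    _ ≤ 2 / m * ‖v‖ ^ 2 := by gcongr

/-- Families of isometric frames subconverge; the limit differs from a given isometric frame by an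
orthogonal transformation. -/
theorem exists_tendsto_frames (g : RiemMetric M) {c : OpenPartialHomeomorph M (Eucl n)}
    (hc : c ∈ atlas (Eucl n) M) {p₀ : M} (hp₀ : p₀ ∈ c.source) (H : M → (Eucl n ≃L[ℝ] Eucl n))
    (hH : ∀ p ∈ c.source, ∀ v w, coeff g c (c p) (H p v) (H p w) = ⟪v, w⟫_ℝ)
    (U : Ultrafilter M) (hU : (U : Filter M) ≤ 𝓝 p₀) :
    ∃ R : Eucl n ≃ₗᵢ[ℝ] Eucl n,
      Tendsto (fun p => (H p : Eucl n →L[ℝ] Eucl n)) U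
        (𝓝 (R.toContinuousLinearEquiv.trans (H p₀) : Eucl n ≃L[ℝ] Eucl n)) := by
  have hsrc : ∀ᶠ p in (U : Filter M), p ∈ c.source := hU (c.open_source.mem_nhds hp₀)
  obtain ⟨C, hC⟩ := exists_norm_le_of_isometric g hc hp₀
  have hb : ∀ᶠ p in (U : Filter M), (H p : Eucl n →L[ℝ] Eucl n) ∈ Metric.closedBall 0 C := by
    filter_upwards [hsrc, hU hC] with p h1 h2
    rw [mem_closedBall_zero_iff]
    exact h2 _ (hH p h1)
  obtain ⟨T, -, hT⟩ := (isCompact_closedBall (0 : Eucl n →L[ℝ] Eucl n) C).ultrafilter_le_nhds'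
    (U.map fun p => (H p : Eucl n →L[ℝ] Eucl n)) hb
  have hT' : Tendsto (fun p => (H p : Eucl n →L[ℝ] Eucl n)) U (𝓝 T) := hT
  have hcoeff : Tendsto (fun p => coeffForm g c (c p)) U (𝓝 (coeffForm g c (c p₀))) :=
    (ContinuousAt.comp (g := coeffForm g c) ((contDiffOn_coeffForm g hc).continuousOn.continuousAt
      (c.open_target.mem_nhds (c.map_source hp₀))) (c.continuousAt hp₀)).tendsto.mono_left hU
  have happ : ∀ v, Tendsto (fun p => H p v) U (𝓝 (T v)) := fun v =>
    tendsto_clm_apply hT' tendsto_const_nhds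
  have hiso : ∀ v w, coeff g c (c p₀) (T v) (T w) = ⟪v, w⟫_ℝ := by
    intro v w
    have h1 : Tendsto (fun p => coeffForm g c (c p) (H p v)) U
        (𝓝 (coeffForm g c (c p₀) (T v))) := tendsto_clm_apply hcoeff (happ v)
    have h2 : Tendsto (fun p => coeffForm g c (c p) (H p v) (H p w)) U
        (𝓝 (coeffForm g c (c p₀) (T v) (T w))) := tendsto_clm_apply h1 (happ w)
    refine tendsto_nhds_unique h2 (tendsto_const_nhds.congr' ?_)
    filter_upwards [hsrc] with p hp using (hH p hp v w).symm
  -- The limit `T` and the frame `H p₀` are both isometric for the metric at `p₀`, so they differ by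
  -- an orthogonal map.
  let R₀ : Eucl n →ₗ[ℝ] Eucl n := ((H p₀).symm : Eucl n →L[ℝ] Eucl n) ∘L T
  have hR₀ : ∀ v, H p₀ (R₀ v) = T v := fun v => (H p₀).apply_symm_apply (T v)
  have hR₀i : ∀ v w, ⟪R₀ v, R₀ w⟫_ℝ = ⟪v, w⟫_ℝ := fun v w => by
    rw [← hH p₀ hp₀, hR₀, hR₀, hiso]
  refine ⟨(R₀.isometryOfInner hR₀i).toLinearIsometryEquiv rfl, ?_⟩
  convert hT' using 2
  ext1 v
  exact hR₀ v

variable (θ : BallFamily n) (r : C(M, Ioi (0 : ℝ)))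

/-- The conjugates converge to `H p₀ ∘ R ∘ θ ∘ R⁻¹ ∘ (H p₀)⁻¹`, and `R` cancels by
`O(n)`-equivariance. The limit is therefore the same for every ultrafilter. -/
theorem smoothTendsto_conj {p₀ : M} {U : Filter M} (hU : U ≤ 𝓝 p₀)
    {H : M → (Eucl n ≃L[ℝ] Eucl n)} {R : Eucl n ≃ₗᵢ[ℝ] Eucl n}
    (hR : Tendsto (fun p => (H p : Eucl n →L[ℝ] Eucl n)) U
        (𝓝 (R.toContinuousLinearEquiv.trans (H p₀) : Eucl n ≃L[ℝ] Eucl n))) (x : Eucl n) :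
    SmoothTendsto U (fun p v => H p (fn (θ.theta (r p)) ((H p).symm v)))
      (fun v => H p₀ (fn (θ.theta (r p₀)) ((H p₀).symm v))) x := by
  have hinv : Tendsto (fun p => ((H p).symm : Eucl n →L[ℝ] Eucl n)) U
      (𝓝 ((R.toContinuousLinearEquiv.trans (H p₀)).symm : Eucl n ≃L[ℝ] Eucl n)) := by
    have h1 := (contDiffAt_map_inverse (𝕜 := ℝ) (n := 0)
      (R.toContinuousLinearEquiv.trans (H p₀))).continuousAt.tendsto.comp hR
    simpa only [Function.comp_def, ContinuousLinearMap.inverse_equiv] using h1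
  have hθ : Tendsto (fun p => θ.theta (r p)) U (𝓝 (θ.theta (r p₀))) :=
    ((θ.continuous.comp r.continuous).tendsto p₀).mono_left hU
  have h := (smoothTendsto_linear hR _).comp ((smoothTendsto_of_tendsto hθ _).comp
    (smoothTendsto_linear hinv x))
  refine h.congr (Eventually.of_forall fun q => EventuallyEq.rfl) (EventuallyEq.of_eq ?_)
  funext v
  change H p₀ (R (fn (θ.theta (r p₀)) (R.symm ((H p₀).symm v)))) = _
  rw [← θ.equivariant, LinearIsometryEquiv.apply_symm_apply]

/-- In a trivialization of the tangent bundle over a chart, the embedding `exp_p ∘ θ_{r(p)}` depends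
continuously on `p`. -/
theorem continuousAt_expTheta (hr : IsInjectivityRadius g r) (i : atlas (Eucl n) M) {p₀ : M}
    (hp₀ : p₀ ∈ i.1.source) (A : M → (Eucl n ≃L[ℝ] Eucl n))
    (hA : ∀ p ∈ i.1.source, (A p : Eucl n →L[ℝ] Eucl n) =
      tangentChange M i (achart (Eucl n) p) p) :
    ContinuousAt (fun p => linEmb (A p) ≫ expTheta θ g r hr p) p₀ := by
  rw [ContinuousAt, tendsto_iff_ultrafilter]
  intro U hU
  let H : M → (Eucl n ≃L[ℝ] Eucl n) := fun p => (frame g p).trans (A p).symm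
  have hH : ∀ p ∈ i.1.source, ∀ v w, coeff g i.1 (i.1 p) (H p v) (H p w) = ⟪v, w⟫_ℝ := by
    intro p hp v w
    rw [coeff_chart g i hp, ← hA p hp, ← innerAt_frame g p v w]
    change innerAt g p (A p ((A p).symm (frame g p v))) (A p ((A p).symm (frame g p w))) = _
    rw [ContinuousLinearEquiv.apply_symm_apply, ContinuousLinearEquiv.apply_symm_apply]
  obtain ⟨R, hR⟩ := exists_tendsto_frames g i.2 hp₀ H hH U hU
  let S : M → Eucl n → Eucl n := fun p v => H p (fn (θ.theta (r p)) ((H p).symm v))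
  have hSc : ∀ p, Continuous (S p) := fun p =>
    (H p).continuous.comp ((contDiff_fn _).continuous.comp (H p).symm.continuous)
  have hexp : ∀ p ∈ i.1.source, ∀ v : Eucl n,
      IsExp g p (tangentChange M i (achart (Eucl n) p) p (S p v))
        (fn (linEmb (A p) ≫ expTheta θ g r hr p) v) := by
    intro p hp v
    have h1 : tangentChange M i (achart (Eucl n) p) p (S p v) =
        fn (thetaAt θ g p (r p)) (A p v) := by
      rw [← hA p hp]
      exact (A p).apply_symm_apply _
    rw [h1]
    exact isExp_expMap (hr.exists_exp p _ (thetaAt_mem θ g p (r p) _))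
  have hsrc : ∀ᶠ p in (U : Filter M), p ∈ i.1.source := hU (i.1.open_source.mem_nhds hp₀)
  refine tendsto_of_smoothTendsto fun x c hc hxc => ?_
  have hS := smoothTendsto_conj θ r hU hR x
  obtain ⟨Ψ, hΨ, hev⟩ := exists_contDiffAt_exp i hp₀ (hexp p₀ hp₀ x) hc hxc
  -- An open set is needed so that the formula for `exp` holds near each point and can be
  -- differentiated.
  obtain ⟨W, hW, hWo, hWs⟩ := eventually_nhds_iff.1 hev
  have hpt : Tendsto (fun q : M × Eucl n => (i.1 q.1, S q.1 q.2)) ((U : Filter M) ×ˢ 𝓝 x)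
      (𝓝 (i.1 p₀, S p₀ x)) :=
    ((((i.1.continuousAt hp₀).tendsto.mono_left hU).comp tendsto_fst).prodMk_nhds hS.tendsto_apply)
  have hall : ∀ᶠ q in (U : Filter M) ×ˢ 𝓝 x, q.1 ∈ i.1.source ∧ (i.1 q.1, S q.1 q.2) ∈ W :=
    (tendsto_fst.eventually hsrc).and (hpt.eventually (hWo.mem_nhds hWs))
  have hloc : ∀ p ∈ i.1.source, ∀ v, (i.1 p, S p v) ∈ W →
      (fun y => Ψ (i.1 p, S p y)) =ᶠ[𝓝 v]
        fun y => c (fn (linEmb (A p) ≫ expTheta θ g r hr p) y) := by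
    intro p hp v hv
    have hcS : Continuous fun y => (i.1 p, S p y) := continuous_const.prodMk (hSc p)
    filter_upwards [hcS.continuousAt.preimage_mem_nhds (hWo.mem_nhds hv)] with y hy
    exact (hW _ hy p hp rfl _ (hexp p hp y)).2.symm
  refine ⟨?_, ?_⟩
  · filter_upwards [hall] with q hq
    exact (hW _ hq.2 q.1 hq.1 rfl _ (hexp q.1 hq.1 q.2)).1
  -- The pair `(i p, S p y)` is written as `(i p, 0) + inr (S p y)`, to present the varying base
  -- point as a convergent family of affine maps.
  · have haff := smoothTendsto_affine (l := (U : Filter M))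
      (a := fun p => (i.1 p, (0 : Eucl n))) (a₀ := (i.1 p₀, (0 : Eucl n)))
      (L := fun _ => ContinuousLinearMap.inr ℝ (Eucl n) (Eucl n))
      (((i.1.continuousAt hp₀).tendsto.mono_left hU).prodMk_nhds tendsto_const_nhds)
      tendsto_const_nhds (S p₀ x)
    have hΨ' : ContDiffAt ℝ ∞ Ψ ((i.1 p₀, (0 : Eucl n)) +
        ContinuousLinearMap.inr ℝ (Eucl n) (Eucl n) (S p₀ x)) := by
      simpa using hΨ
    have h := SmoothTendsto.comp (f := S) (f₀ := S p₀)
      (SmoothTendsto.comp (g := fun _ => Ψ) (g₀ := Ψ) (smoothTendsto_const hΨ') haff) hS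
    simp only [ContinuousLinearMap.inr_apply, Prod.mk_add_mk, add_zero, zero_add] at h
    exact h.congr (hall.mono fun q hq => hloc q.1 hq.1 q.2 hq.2) (hloc p₀ hp₀ x hWs)

end Frames

/-! ### Sheaves of topological spaces -/

section Sheaf

variable {n : ℕ} {Φ : (Man n)ᵒᵖ ⥤ TopCat.{v}} {M : Man n}

/-- The sieve generated by a family of open embeddings. -/
def familySieve {ι : Type*} {N : ι → Man n} (e : ∀ i, N i ⟶ M) : Sieve M where
  arrows _ f := ∃ i k, f = k ≫ e i
  downward_closed := by
    rintro Y Z f ⟨i, k, rfl⟩ h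
    exact ⟨i, h ≫ k, by simp⟩

theorem familySieve_mem {ι : Type*} {N : ι → Man n} (e : ∀ i, N i ⟶ M)
    (he : ∀ p, ∃ i, p ∈ range (fn (e i))) : familySieve e ∈ openCoverTopology n M := fun p => by
  obtain ⟨i, hi⟩ := he p
  exact ⟨N i, e i, ⟨i, 𝟙 _, by simp⟩, hi⟩

/-- Elements of the values of a sheaf are determined by their restrictions to an open cover. -/
theorem eq_of_map_eq (hΦ : Presheaf.IsSheaf (openCoverTopology n) Φ) {ι : Type*}
    {N : ι → Man n} (e : ∀ i, N i ⟶ M) (he : ∀ p, ∃ i, p ∈ range (fn (e i)))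
    {x y : Φ.obj (op M)} (h : ∀ i, Φ.map (e i).op x = Φ.map (e i).op y) : x = y := by
  let S : (openCoverTopology n).Cover M := ⟨familySieve e, familySieve_mem e he⟩
  -- Points become maps from a one-point space, to which the separatedness of the sheaf applies.
  let f (z : Φ.obj (op M)) : TopCat.of PUnit.{v + 1} ⟶ Φ.obj (op M) :=
    TopCat.ofHom (ContinuousMap.const _ z)
  have hf : f x = f y := by
    refine hΦ.hom_ext S _ _ ?_
    rintro ⟨Z, _, i, k, rfl⟩
    ext u
    change Φ.map (k ≫ e i).op x = Φ.map (k ≫ e i).op y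
    simp [h i]
  exact congrArg (fun f : TopCat.of PUnit.{v + 1} ⟶ Φ.obj (op M) => f PUnit.unit) hf

/-- The values of a sheaf of topological spaces carry the topology induced by the restrictions to the
members of an open cover. -/
theorem continuous_of_cover (hΦ : Presheaf.IsSheaf (openCoverTopology n) Φ) {ι : Type*}
    {N : ι → Man n} (e : ∀ i, N i ⟶ M) (he : ∀ p, ∃ i, p ∈ range (fn (e i))) {Y : Type v}
    [TopologicalSpace Y] (h : Y → Φ.obj (op M)) (hc : ∀ i, Continuous fun y => Φ.map (e i).op (h y)) :
    Continuous h := by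
  have hcont : ∀ (Z : Man n) (f : Z ⟶ M), (familySieve e).arrows f →
      Continuous fun y => Φ.map f.op (h y) := by
    rintro Z f ⟨i, k, rfl⟩
    have h2 : (fun y => Φ.map (k ≫ e i).op (h y)) = fun y => Φ.map k.op (Φ.map (e i).op (h y)) := by
      funext y; simp
    rw [h2]
    exact (Φ.map k.op).hom.continuous.comp (hc i)
  let S : (openCoverTopology n).Cover M := ⟨familySieve e, familySieve_mem e he⟩
  let x (I : S.Arrow) : TopCat.of Y ⟶ Φ.obj (op I.Y) :=
    TopCat.ofHom ⟨fun y => Φ.map I.f.op (h y), hcont I.Y I.f I.hf⟩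
  have hx : ∀ ⦃I₁ I₂ : S.Arrow⦄ (r : I₁.Relation I₂),
      x I₁ ≫ Φ.map r.g₁.op = x I₂ ≫ Φ.map r.g₂.op := fun I₁ I₂ r => by
    ext y
    change Φ.map r.g₁.op (Φ.map I₁.f.op (h y)) = Φ.map r.g₂.op (Φ.map I₂.f.op (h y))
    rw [← ConcreteCategory.comp_apply, ← ConcreteCategory.comp_apply, ← Φ.map_comp,
      ← Φ.map_comp, ← op_comp, ← op_comp, r.w]
  -- The restrictions of `h` glue to a continuous map, which is `h` because elements are determined
  -- on the cover.
  have ht : ⇑(hΦ.amalgamate S x hx) = h := by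
    funext y
    refine eq_of_map_eq hΦ e he fun i => ?_
    have h1 := hΦ.amalgamate_map S x hx ⟨N i, e i, i, 𝟙 _, by simp⟩
    exact congrArg (fun f : TopCat.of Y ⟶ Φ.obj (op (N i)) => f y) h1
  rw [← ht]
  exact (hΦ.amalgamate S x hx).hom.continuous

end Sheaf

/-! ### The scanning map -/

section Scan

variable {n : ℕ} {Φ : (Man n)ᵒᵖ ⥤ TopCat.{v}} (hΦ : IsContinuousFunctor Φ) (θ : BallFamily n)
  {M : Man n} {g : RiemMetric M} (r : C(M, Ioi (0 : ℝ))) (hr : IsInjectivityRadius g r)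

/-- In the trivialization at the chart of `p₀`, the action on the fibre becomes precomposition with
a linear embedding. The scan is then `Φ` of a continuous family of embeddings `ℝⁿ → M`. -/
theorem continuous_scan :
    Continuous fun q : Φ.obj (op M) × M => scan Φ hΦ θ g r hr q.1 q.2 := by
  refine continuous_iff_continuousAt.2 fun ⟨x₀, p₀⟩ => ?_
  rw [FiberBundle.continuousAt_totalSpace]
  refine ⟨continuous_snd.continuousAt, ?_⟩
  let i := achart (Eucl n) p₀
  have hp₀ : p₀ ∈ i.1.source := mem_chart_source (Eucl n) p₀
  have hex : ∀ p : M, ∃ e : Eucl n ≃L[ℝ] Eucl n, p ∈ i.1.source →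
      (e : Eucl n →L[ℝ] Eucl n) = tangentChange M i (achart (Eucl n) p) p := fun p => by
    by_cases hp : p ∈ i.1.source
    · obtain ⟨e, he⟩ := exists_tangentChange M i (achart (Eucl n) p) p
        ⟨hp, mem_chart_source (Eucl n) p⟩
      exact ⟨e, fun _ => he⟩
    -- Off the chart domain the value is irrelevant.
    · exact ⟨ContinuousLinearEquiv.refl ℝ (Eucl n), fun h => (hp h).elim⟩
  choose A hA using hex
  have hE := continuousAt_expTheta θ r hr i hp₀ A hA
  have hc : ContinuousAt (fun q : Φ.obj (op M) × M =>
      Φ.map (linEmb (A q.2) ≫ expTheta θ g r hr q.2).op q.1) (x₀, p₀) :=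
    (hΦ (Rn n) M).continuousAt.comp
      ((ContinuousAt.comp (f := Prod.snd) (x := (x₀, p₀)) hE continuousAt_snd).prodMk
        continuousAt_fst)
  refine hc.congr ?_
  filter_upwards [continuous_snd.continuousAt.preimage_mem_nhds (i.1.open_source.mem_nhds hp₀)]
    with q hq
  change _ = linAct Φ (tangentChange M i (achart (Eucl n) q.2) q.2)
    (Φ.map (expTheta θ g r hr q.2).op q.1)
  rw [← hA q.2 hq, linAct_coe]
  simp

variable {hΦ r hr}

/-- The topology of `Φ(M)` is induced by the values of the scanning map. -/
theorem continuous_of_scan (hsheaf : Presheaf.IsSheaf (openCoverTopology n) Φ) {Y : Type v}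
    [TopologicalSpace Y] {h : Y → Φ.obj (op M)}
    (hc : ∀ p, Continuous fun y => scan Φ hΦ θ g r hr (h y) p) : Continuous h :=
  continuous_of_cover hsheaf (fun p => expTheta θ g r hr p)
    (fun p => ⟨p, mem_range_expTheta θ r hr p⟩) h fun p =>
      (FiberBundle.totalSpaceMk_isInducing (Φ.obj (op (Rn n)))
        (fibBundle Φ hΦ M).Fiber p).continuous_iff.2 (hc p)

end Scan

end Scanning

end

/-! ### The embedding theorem -/

open CategoryTheory Opposite Scanning Topology
theorem mainTheorem2 {n : ℕ} (Φ : (Man n)ᵒᵖ ⥤ TopCat.{v}) (hΦ : IsTopologicalSheaf Φ)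
    (θ : BallFamily n) (M : Man n) (g : RiemMetric M) (r : C(M, Set.Ioi (0 : ℝ)))
    (hr : IsInjectivityRadius g r) :
    ∃ hcont : ∀ x : Φ.obj (op M), Continuous (scan Φ hΦ.continuous θ g r hr x),
      IsEmbedding fun x : Φ.obj (op M) =>
        (⟨⟨scan Φ hΦ.continuous θ g r hr x, hcont x⟩, fun _ => rfl⟩ :
          Sections Φ hΦ.continuous M) := by
  have hjoint := continuous_scan hΦ.continuous θ r hr
  refine ⟨fun x => hjoint.comp (Continuous.prodMk_right x), ⟨⟨le_antisymm ?_ ?_⟩, ?_⟩⟩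
  · refine Continuous.le_induced ?_
    exact (ContinuousMap.curry ⟨_, hjoint⟩).continuous.subtype_mk _
  -- The identity from the induced topology to that of `Φ(M)` is tested on the values of the scan at
  -- points, which are evaluations of sections.
  · rw [← continuous_id_iff_le]
    refine @continuous_of_scan _ _ hΦ.continuous θ _ _ r hr hΦ.isSheaf _
      (TopologicalSpace.induced _ _) id fun p => ?_
    have hev : Continuous fun s : Sections Φ hΦ.continuous M => s.1 p :=
      (ContinuousEvalConst.continuous_eval_const p).comp continuous_subtype_val
    let F : Φ.obj (op M) → Sections Φ hΦ.continuous M := fun x =>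
      ⟨⟨scan Φ hΦ.continuous θ g r hr x, hjoint.comp (Continuous.prodMk_right x)⟩, fun _ => rfl⟩
    exact @Continuous.comp _ _ _ (_) _ _ F (fun s : Sections Φ hΦ.continuous M => s.1 p) hev
      continuous_induced_dom
  · intro x y hxy
    refine eq_of_map_eq hΦ.isSheaf (fun p => expTheta θ g r hr p)
      (fun p => ⟨p, mem_range_expTheta θ r hr p⟩) fun p => ?_
    have h : scan Φ hΦ.continuous θ g r hr x p = scan Φ hΦ.continuous θ g r hr y p :=
      congrArg (fun s : Sections Φ hΦ.continuous M => s.1 p) hxy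
    injection h
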